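/- Let $n\ge 1$. Call a homeomorphism between open subsets of the cube $I^n=[0,1]^n$ \emph{piecewise linear} if every point of its domain has a neighbourhood which is a union of finitely many linear simplices contained in the domain, on each of which the map is affine, and likewise for the inverse map. It is \emph{orientation preserving} if each of the affine pieces (of the map and of its inverse) of full dimension $n$ has a linear part of positive determinant. A \emph{PL manifold} of dimension $n$ is a Hausdorff space $M$ with an atlas of charts onto open subsets of $I^n$ whose transition maps are piecewise linear (so $M$ may have boundary); it is \emph{oriented} if the transition maps are moreover orientation preserving. Let $\mathrm{PL}(M)$ be the group of all homeomorphisms of $M$ that are piecewise linear when read in the charts and, for oriented $M$, let $\mathrm{PL}^+(M)$ be the group of those that are piecewise linear and orientation preserving when read in the charts. Theorem. Let $M$ be a nonempty PL manifold of dimension $n\ge 1$ (compact or not). Then there is no topology on the group $\mathrm{PL}(M)$ that makes it a Polish (separable and completely metrizable) topological group. If $M$ is oriented, then $\mathrm{PL}^+(M)$ also admits no Polish group topology. -/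

import Mathlib

open Set Topology
open scoped Manifold

namespace PLGroup

/-- A linear simplex in `ℝⁿ`: the convex hull of a finite affinely independent set
(of any dimension). -/
def IsSimplex {n : ℕ} (P : Set (Fin n → ℝ)) : Prop :=
  ∃ σ : Finset (Fin n → ℝ),
    AffineIndependent ℝ ((↑) : σ → (Fin n → ℝ)) ∧ P = convexHull ℝ (σ : Set (Fin n → ℝ))

/-- The cube `Iⁿ = [0,1]ⁿ`, as a subspace of `ℝⁿ`. -/
abbrev Cube (n : ℕ) : Type := ↥(Set.Icc (0 : Fin n → ℝ) 1)

/-- `f : Iⁿ → Iⁿ` is affine on the set `P`. -/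
def IsAffineOn {n : ℕ} (f : Cube n → Cube n) (P : Set (Fin n → ℝ)) : Prop :=
  ∃ A : (Fin n → ℝ) →ᵃ[ℝ] (Fin n → ℝ), ∀ y : Cube n, (y : Fin n → ℝ) ∈ P → (f y : Fin n → ℝ) = A y

/-- `f` is piecewise linear on the (open) subset `s` of the cube: it is continuous there, and
every point of `s` has a neighbourhood that is a union of finitely many linear simplices,
contained in `s`, such that `f` is affine on each of them. -/
structure IsPLOn {n : ℕ} (f : Cube n → Cube n) (s : Set (Cube n)) : Prop where
  continuousOn : ContinuousOn f s
  exists_simplices : ∀ x ∈ s, ∃ T : Set (Set (Fin n → ℝ)), T.Finite ∧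
    (∀ P ∈ T, IsSimplex P ∧ P ⊆ (fun y : Cube n => (y : Fin n → ℝ)) '' s ∧ IsAffineOn f P) ∧
    {y : Cube n | ∃ P ∈ T, (y : Fin n → ℝ) ∈ P} ∈ 𝓝 x

/-- `f` is piecewise linear and orientation preserving on `s`: moreover, each of its affine
pieces of full dimension has a linear part of positive determinant. -/
structure IsOrientedPLOn {n : ℕ} (f : Cube n → Cube n) (s : Set (Cube n)) : Prop
    extends IsPLOn f s where
  det_pos : ∀ U : Set (Cube n), IsOpen U → U.Nonempty → U ⊆ s →
    ∀ A : (Fin n → ℝ) →ᵃ[ℝ] (Fin n → ℝ), (∀ y ∈ U, (f y : Fin n → ℝ) = A y) →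
      0 < LinearMap.det A.linear

section Polytopes

variable {n : ℕ}

/-- A compact finite intersection of closed half-spaces is a finite union of simplices. -/
theorem exists_simplices_of_halfspaces {ι : Type*} [Finite ι]
    (L : ι → ((Fin n → ℝ) →ᵃ[ℝ] ℝ)) (hc : IsCompact {x | ∀ i, 0 ≤ L i x}) :
    ∃ T : Set (Set (Fin n → ℝ)), T.Finite ∧ (∀ P ∈ T, IsSimplex P) ∧
      ⋃₀ T = {x | ∀ i, 0 ≤ L i x} := by
  classical
  have := Fintype.ofFinite ι
  set K : Set (Fin n → ℝ) := {x | ∀ i, 0 ≤ L i x} with hK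
  have hconv : Convex ℝ K := by
    have : K = ⋂ i, (L i) ⁻¹' (Set.Ici 0) := by
      ext x; simp [hK]
    rw [this]
    exact convex_iInter fun i => (convex_Ici (0 : ℝ)).affine_preimage (L i)
  have hfin : (K.extremePoints ℝ).Finite := by
    have hinj : Set.InjOn (fun x => {i | L i x = 0}) (K.extremePoints ℝ) := by
      intro x hx y hy hxy
      by_contra hne
      have hact : ∀ i, L i x = 0 → L i y = 0 := by
        intro i hi
        have : i ∈ {i | L i x = 0} := hi
        rw [show {i | L i x = 0} = {i | L i y = 0} from hxy] at this
        exact this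
      have hlin : ∀ i (t : ℝ), L i (AffineMap.lineMap x y t) = L i x + t * (L i y - L i x) := by
        intro i t
        rw [AffineMap.apply_lineMap, AffineMap.lineMap_apply]
        simp; ring
      have hev : ∀ᶠ t : ℝ in 𝓝 0, AffineMap.lineMap x y t ∈ K := by
        have : ∀ i, ∀ᶠ t : ℝ in 𝓝 0, 0 ≤ L i (AffineMap.lineMap x y t) := by
          intro i
          simp only [hlin]
          rcases (hx.1 i).eq_or_lt with h0 | h0
          · have h1 := hact i h0.symm
            simp [← h0, h1]
          · have hcont : Continuous fun t : ℝ => L i x + t * (L i y - L i x) := by fun_prop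
            have := hcont.tendsto 0
            simp only [zero_mul, add_zero] at this
            filter_upwards [this.eventually (lt_mem_nhds h0)] with t ht using ht.le
        simpa [hK] using Filter.eventually_all.2 this
      obtain ⟨ε, hε, hball⟩ := Metric.eventually_nhds_iff.1 hev
      have h1 : AffineMap.lineMap x y (ε / 2) ∈ K :=
        hball (by rw [dist_zero_right, Real.norm_eq_abs, abs_of_pos (half_pos hε)]; exact half_lt_self hε)
      have h2 : AffineMap.lineMap x y (-(ε / 2)) ∈ K :=
        hball (by rw [dist_zero_right, norm_neg, Real.norm_eq_abs, abs_of_pos (half_pos hε)]; exact half_lt_self hε)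
      have h3 := (mem_extremePoints_iff_left.1 hx).2 _ h1 _ h2
        ⟨1 / 2, 1 / 2, by norm_num, by norm_num, by norm_num, by
          simp only [AffineMap.lineMap_apply_module]
          module⟩
      rw [AffineMap.lineMap_apply_module] at h3
      have h4 : (ε / 2) • (y - x) = 0 := by
        have : (ε / 2) • (y - x) = ((1 - ε / 2) • x + (ε / 2) • y) - x := by module
        rw [this, h3, sub_self]
      rcases smul_eq_zero.1 h4 with h | h
      · linarith
      · exact hne (sub_eq_zero.1 h).symm
    exact Set.Finite.of_finite_image (Set.toFinite _) hinj
  have hKM : convexHull ℝ (K.extremePoints ℝ) = K := by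
    have := closure_convexHull_extremePoints hc hconv
    rwa [(hfin.isCompact_convexHull ℝ).isClosed.closure_eq] at this
  refine ⟨(fun σ : Finset (Fin n → ℝ) => convexHull ℝ (σ : Set (Fin n → ℝ))) ''
    {σ | (σ : Set (Fin n → ℝ)) ⊆ K.extremePoints ℝ ∧
      AffineIndependent ℝ ((↑) : σ → (Fin n → ℝ))}, ?_, ?_, ?_⟩
  · apply Set.Finite.image
    refine (hfin.toFinset.powerset.finite_toSet).subset ?_
    rintro σ ⟨hσ, -⟩
    simp only [Finset.coe_powerset, Set.mem_preimage, Set.mem_powerset_iff]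
    simpa using hσ
  · rintro P ⟨σ, ⟨-, hσ⟩, rfl⟩
    exact ⟨σ, hσ, rfl⟩
  · have h := convexHull_eq_union (𝕜 := ℝ) (s := K.extremePoints ℝ)
    rw [hKM] at h
    refine Eq.trans ?_ h.symm
    ext x
    simp only [Set.sUnion_image, Set.mem_ofPred_eq, Set.mem_iUnion, exists_prop, and_assoc]

/-- A simplex is a finite intersection of closed half-spaces. -/
theorem IsSimplex.exists_halfspaces {P : Set (Fin n → ℝ)} (hP : IsSimplex P) :
    ∃ (ι : Type) (_ : Finite ι) (L : ι → ((Fin n → ℝ) →ᵃ[ℝ] ℝ)), P = {x | ∀ i, 0 ≤ L i x} := by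
  classical
  obtain ⟨σ, hσ, rfl⟩ := hP
  obtain ⟨t, hst, hind, hspan⟩ :=
    exists_subset_affineIndependent_affineSpan_eq_top (s := (σ : Set (Fin n → ℝ))) hσ
  let b : AffineBasis t ℝ (Fin n → ℝ) := ⟨fun p => (p : Fin n → ℝ), hind, by simpa using hspan⟩
  have hbc : ∀ p, b p = (p : Fin n → ℝ) := fun _ => rfl
  have : Finite t := finite_set_of_fin_dim_affineIndependent ℝ hind
  have := Fintype.ofFinite t
  let c : t → ((Fin n → ℝ) →ᵃ[ℝ] ℝ) :=
    fun p => if (p : Fin n → ℝ) ∈ σ then b.coord p else - b.coord p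
  let d : t ⊕ t → ((Fin n → ℝ) →ᵃ[ℝ] ℝ) := Sum.elim (fun p => b.coord p) c
  have key : convexHull ℝ (σ : Set (Fin n → ℝ)) = {x | ∀ i : t ⊕ t, 0 ≤ d i x} := by
    have hconv : Convex ℝ {x | ∀ i : t ⊕ t, 0 ≤ d i x} := by
      have : {x | ∀ i : t ⊕ t, 0 ≤ d i x}
          = ⋂ i : t ⊕ t, (d i) ⁻¹' (Set.Ici 0) := by
        ext x; simp
      rw [this]
      exact convex_iInter fun i => (convex_Ici (0 : ℝ)).affine_preimage _
    apply Set.Subset.antisymm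
    · refine convexHull_min ?_ hconv
      intro p hp
      have h0 : ∀ q : t, b.coord q p = if q = ⟨p, hst hp⟩ then 1 else 0 := by
        intro q
        have := b.coord_apply q ⟨p, hst hp⟩
        rwa [hbc] at this
      rintro (q | q)
      · simp only [d, Sum.elim_inl, h0]
        split_ifs <;> norm_num
      · simp only [d, Sum.elim_inr, c]
        split_ifs with hq
        · rw [h0]; split_ifs <;> norm_num
        · have : q ≠ ⟨p, hst hp⟩ := by
            rintro rfl
            exact hq hp
          simp [h0, this]
    · intro x hx
      have h1 : ∀ q : t, 0 ≤ b.coord q x := fun q => hx (Sum.inl q)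
      have h2 : ∀ q : t, (q : Fin n → ℝ) ∉ σ → b.coord q x = 0 := by
        intro q hq
        have := hx (Sum.inr q)
        simp only [d, Sum.elim_inr, c, if_neg hq] at this
        have h3 : 0 ≤ - (b.coord q x) := this
        linarith [h1 q]
      have hsum := b.sum_coord_apply_eq_one x
      have hlin := b.linear_combination_coord_eq_self x
      have e1 : ∑ q ∈ Finset.univ.filter (fun q : t => (q : Fin n → ℝ) ∈ σ), b.coord q x = 1 := by
        rw [Finset.sum_filter_of_ne, hsum]
        intro q _ hq
        by_contra h
        exact hq (h2 q h)
      have e2 : ∑ q ∈ Finset.univ.filter (fun q : t => (q : Fin n → ℝ) ∈ σ),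
          b.coord q x • b q = x := by
        rw [Finset.sum_filter_of_ne, hlin]
        intro q _ hq
        by_contra h
        exact hq (by rw [h2 q h, zero_smul])
      rw [← e2]
      refine (convex_convexHull ℝ _).sum_mem (fun q _ => h1 q) e1 (fun q hq => ?_)
      exact subset_convexHull ℝ _ (Finset.mem_coe.2 (Finset.mem_filter.1 hq).2)
  let e := Finite.equivFin (t ⊕ t)
  refine ⟨Fin (Nat.card (t ⊕ t)), inferInstance, fun i => d (e.symm i), ?_⟩
  rw [key]
  ext x
  exact ⟨fun h i => h _, fun h i => by simpa using h (e i)⟩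

theorem IsSimplex.isCompact {P : Set (Fin n → ℝ)} (hP : IsSimplex P) : IsCompact P := by
  obtain ⟨σ, -, rfl⟩ := hP
  exact σ.finite_toSet.isCompact_convexHull ℝ

/-- The intersection of a simplex with the affine preimage of a simplex is a finite union of
simplices. -/
theorem IsSimplex.inter_preimage {P Q : Set (Fin n → ℝ)} (hP : IsSimplex P) (hQ : IsSimplex Q)
    (A : (Fin n → ℝ) →ᵃ[ℝ] (Fin n → ℝ)) :
    ∃ T : Set (Set (Fin n → ℝ)), T.Finite ∧ (∀ R ∈ T, IsSimplex R) ∧ ⋃₀ T = P ∩ A ⁻¹' Q := by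
  have hcl : IsCompact (P ∩ A ⁻¹' Q) :=
    hP.isCompact.inter_right (hQ.isCompact.isClosed.preimage A.continuous_of_finiteDimensional)
  obtain ⟨ι, _, L, hL⟩ := hP.exists_halfspaces
  obtain ⟨κ, _, M, hM⟩ := hQ.exists_halfspaces
  have e : P ∩ A ⁻¹' Q = {x | ∀ i, 0 ≤ (Sum.elim L (fun k => (M k).comp A) : ι ⊕ κ → _) i x} := by
    ext x
    simp [hL, hM]
  rw [e] at hcl ⊢
  exact exists_simplices_of_halfspaces _ hcl

/-- Every point of an open subset of the cube has a neighbourhood in it that is a finite union of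
simplices. -/
theorem exists_simplices_nhds {s : Set (Cube n)} (hs : IsOpen s) {x : Cube n} (hx : x ∈ s) :
    ∃ T : Set (Set (Fin n → ℝ)), T.Finite ∧
      (∀ P ∈ T, IsSimplex P ∧ P ⊆ (fun y : Cube n => (y : Fin n → ℝ)) '' s) ∧
      {y : Cube n | ∃ P ∈ T, (y : Fin n → ℝ) ∈ P} ∈ 𝓝 x := by
  obtain ⟨ε, hε, hb⟩ := Metric.isOpen_iff.1 hs x hx
  let pr : Fin n → ((Fin n → ℝ) →ᵃ[ℝ] ℝ) := fun i =>
    (LinearMap.proj i : (Fin n → ℝ) →ₗ[ℝ] ℝ).toAffineMap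
  let cst : ℝ → ((Fin n → ℝ) →ᵃ[ℝ] ℝ) := fun r => AffineMap.const ℝ (Fin n → ℝ) r
  let L : (Fin n × Fin 4) → ((Fin n → ℝ) →ᵃ[ℝ] ℝ) := fun p =>
    ![pr p.1, cst 1 - pr p.1, pr p.1 - cst (x.1 p.1 - ε / 2), cst (x.1 p.1 + ε / 2) - pr p.1] p.2
  have hL : {y | ∀ p, 0 ≤ L p y} = Set.Icc (0 : Fin n → ℝ) 1 ∩ Metric.closedBall x.1 (ε / 2) := by
    ext y
    simp only [Set.mem_ofPred_eq, Prod.forall, Fin.forall_fin_succ, Set.mem_inter_iff, Set.mem_Icc,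
      Metric.mem_closedBall, dist_pi_le_iff (half_pos hε).le, Pi.le_def, Real.dist_eq, abs_le]
    simp [L, pr, cst]
    constructor
    · intro h
      exact ⟨⟨fun i => (h i).1, fun i => (h i).2.1⟩,
        fun i => ⟨by linarith [(h i).2.2.1], by linarith [(h i).2.2.2]⟩⟩
    · rintro ⟨⟨h1, h2⟩, h3⟩ i
      exact ⟨h1 i, h2 i, by linarith [(h3 i).1], by linarith [(h3 i).2]⟩
  have hc : IsCompact {y | ∀ p, 0 ≤ L p y} := by
    rw [hL]
    exact (isCompact_closedBall _ _).inter_left isClosed_Icc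
  obtain ⟨T, hT, hTs, hTu⟩ := exists_simplices_of_halfspaces L hc
  rw [hL] at hTu
  refine ⟨T, hT, fun P hP => ⟨hTs P hP, fun y hy => ?_⟩, ?_⟩
  · have : y ∈ ⋃₀ T := ⟨P, hP, hy⟩
    rw [hTu] at this
    refine ⟨⟨y, this.1⟩, hb ?_, rfl⟩
    have h2 := Metric.mem_closedBall.1 this.2
    rw [Metric.mem_ball, Subtype.dist_eq]
    exact lt_of_le_of_lt h2 (by linarith)
  · refine Filter.mem_of_superset (Metric.closedBall_mem_nhds x (half_pos hε)) fun y hy => ?_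
    have : (y : Fin n → ℝ) ∈ ⋃₀ T := by
      rw [hTu]
      exact ⟨y.2, hy⟩
    exact this

/-- A nonempty relatively open subset of the cube contains a nonempty open subset of `ℝⁿ`. -/
theorem exists_isOpen_subset_cube {U : Set (Cube n)} (hU : IsOpen U) (hne : U.Nonempty) :
    ∃ W : Set (Fin n → ℝ), IsOpen W ∧ W.Nonempty ∧
      W ⊆ (fun y : Cube n => (y : Fin n → ℝ)) '' U := by
  obtain ⟨V, hV, rfl⟩ := isOpen_induced_iff.1 hU
  obtain ⟨x, hx⟩ := hne
  have hint : (interior (Set.Icc (0 : Fin n → ℝ) 1)).Nonempty := by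
    refine ⟨fun _ => 1 / 2, ?_⟩
    refine mem_interior.2 ⟨Set.pi Set.univ (fun _ => Set.Ioo 0 1), ?_,
      isOpen_set_pi Set.finite_univ (fun _ _ => isOpen_Ioo), ?_⟩
    · intro y hy
      exact ⟨fun i => (hy i trivial).1.le, fun i => (hy i trivial).2.le⟩
    · intro i _
      constructor <;> norm_num
  have hcl := (convex_Icc (𝕜 := ℝ) (0 : Fin n → ℝ) 1).closure_interior_eq_closure_of_nonempty_interior
    hint
  have hx' : (x : Fin n → ℝ) ∈ closure (interior (Set.Icc (0 : Fin n → ℝ) 1)) := by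
    rw [hcl]
    exact subset_closure x.2
  obtain ⟨z, hzV, hzI⟩ := mem_closure_iff.1 hx' V hV hx
  exact ⟨V ∩ interior (Set.Icc 0 1), hV.inter isOpen_interior, ⟨z, hzV, hzI⟩,
    fun y hy => ⟨⟨y, interior_subset hy.2⟩, hy.1, rfl⟩⟩

/-- A piecewise linear map agrees with an affine map on some nonempty open subset of every
nonempty open set. -/
theorem IsPLOn.exists_isOpen_affine {f : Cube n → Cube n} {s U : Set (Cube n)} (hf : IsPLOn f s)
    (hU : IsOpen U) (hne : U.Nonempty) (hUs : U ⊆ s) :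
    ∃ V ⊆ U, IsOpen V ∧ V.Nonempty ∧ ∃ A : (Fin n → ℝ) →ᵃ[ℝ] (Fin n → ℝ),
      ∀ y ∈ V, (f y : Fin n → ℝ) = A y := by
  obtain ⟨x, hx⟩ := hne
  obtain ⟨T, hT, hTs, hTn⟩ := hf.exists_simplices x (hUs hx)
  have claim : ∀ S : Set (Set (Fin n → ℝ)), S.Finite → S ⊆ T →
      (∀ P ∈ S, interior ((fun y : Cube n => (y : Fin n → ℝ)) ⁻¹' P ∩ closure U) = ∅) →
      interior (⋃ P ∈ S, ((fun y : Cube n => (y : Fin n → ℝ)) ⁻¹' P ∩ closure U)) = ∅ := by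
    intro S hS
    induction S, hS using Set.Finite.induction_on with
    | empty => simp
    | @insert P S _ _ ih =>
      intro hST hS
      rw [Set.biUnion_insert, interior_union_isClosed_of_interior_empty]
      · exact hS P (Set.mem_insert _ _)
      · exact ((hTs P (hST (Set.mem_insert _ _))).1.isCompact.isClosed.preimage
          continuous_subtype_val).inter isClosed_closure
      · exact ih (fun Q hQ => hST (Set.mem_insert_of_mem _ hQ))
          (fun Q hQ => hS Q (Set.mem_insert_of_mem _ hQ))
  by_cases h : ∀ P ∈ T, interior ((fun y : Cube n => (y : Fin n → ℝ)) ⁻¹' P ∩ closure U) = ∅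
  · exfalso
    have h1 := claim T hT subset_rfl h
    have h2 : x ∈ interior (⋃ P ∈ T, ((fun y : Cube n => (y : Fin n → ℝ)) ⁻¹' P ∩ closure U)) := by
      rw [mem_interior_iff_mem_nhds]
      filter_upwards [hTn, hU.mem_nhds hx] with y ⟨P, hP, hy⟩ hyU
      exact Set.mem_biUnion hP ⟨hy, subset_closure hyU⟩
    rw [h1] at h2
    exact h2
  · push Not at h
    obtain ⟨P, hP, z, hz⟩ := h
    obtain ⟨A, hA⟩ := (hTs P hP).2.2
    have hzc := (interior_subset hz).2
    obtain ⟨w, hw⟩ := mem_closure_iff.1 hzc _ isOpen_interior hz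
    exact ⟨U ∩ interior ((fun y : Cube n => (y : Fin n → ℝ)) ⁻¹' P ∩ closure U),
      Set.inter_subset_left, hU.inter isOpen_interior, ⟨w, hw.2, hw.1⟩, A,
      fun y hy => hA y (interior_subset hy.2).1⟩

end Polytopes

section Stability

variable {n : ℕ} {f g : Cube n → Cube n} {u v : Set (Cube n)}

theorem IsPLOn.comp (hf : IsPLOn f u) (hg : IsPLOn g v) (hu : IsOpen u) :
    IsPLOn (g ∘ f) (u ∩ f ⁻¹' v) := by
  refine ⟨hg.continuousOn.comp (hf.continuousOn.mono Set.inter_subset_left) fun x hx => hx.2, ?_⟩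
  rintro x ⟨hxu, hxv⟩
  obtain ⟨S, hS, hSs, hSn⟩ := hf.exists_simplices x hxu
  obtain ⟨T, hT, hTs, hTn⟩ := hg.exists_simplices (f x) hxv
  have hex : ∀ P Q : Set (Fin n → ℝ), ∃ R : Set (Set (Fin n → ℝ)), P ∈ S → Q ∈ T →
      R.Finite ∧ (∀ K ∈ R, IsSimplex K ∧
        K ⊆ (fun y : Cube n => (y : Fin n → ℝ)) '' (u ∩ f ⁻¹' v) ∧ IsAffineOn (g ∘ f) K) ∧
      ∀ y : Cube n, (y : Fin n → ℝ) ∈ P → (f y : Fin n → ℝ) ∈ Q →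
        ∃ K ∈ R, (y : Fin n → ℝ) ∈ K := by
    intro P Q
    by_cases hPQ : P ∈ S ∧ Q ∈ T
    · obtain ⟨hP, hQ⟩ := hPQ
      obtain ⟨hPs, hPu, A, hA⟩ := hSs P hP
      obtain ⟨hQs, hQv, B, hB⟩ := hTs Q hQ
      obtain ⟨R, hR, hRs, hRu⟩ := hPs.inter_preimage hQs A
      refine ⟨R, fun _ _ => ⟨hR, fun K hK => ⟨hRs K hK, fun y hy => ?_, B.comp A, fun y hy => ?_⟩,
        fun y hyP hyQ => ?_⟩⟩
      · have hy' : y ∈ P ∩ A ⁻¹' Q := hRu ▸ (⟨K, hK, hy⟩ : y ∈ ⋃₀ R)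
        obtain ⟨z, hz, rfl⟩ := hPu hy'.1
        have h1 : (f z : Fin n → ℝ) ∈ Q := by
          rw [hA z hy'.1]; exact hy'.2
        obtain ⟨w, hw, hwz⟩ := hQv h1
        have : w = f z := Subtype.ext hwz
        exact ⟨z, ⟨hz, by rw [Set.mem_preimage, ← this]; exact hw⟩, rfl⟩
      · have hy' : (y : Fin n → ℝ) ∈ P ∩ A ⁻¹' Q := hRu ▸ (⟨K, hK, hy⟩ : (y : Fin n → ℝ) ∈ ⋃₀ R)
        have h1 : (f y : Fin n → ℝ) ∈ Q := by
          rw [hA y hy'.1]; exact hy'.2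
        rw [Function.comp_apply, hB _ h1, hA y hy'.1, AffineMap.comp_apply]
      · have : (y : Fin n → ℝ) ∈ ⋃₀ R := by
          rw [hRu]
          refine ⟨hyP, ?_⟩
          rw [Set.mem_preimage, ← hA y hyP]
          exact hyQ
        exact this
    · exact ⟨∅, fun hP hQ => absurd ⟨hP, hQ⟩ hPQ⟩
  choose R hR using hex
  refine ⟨⋃ P ∈ S, ⋃ Q ∈ T, R P Q, hS.biUnion fun P hP => hT.biUnion fun Q hQ => (hR P Q hP hQ).1,
    ?_, ?_⟩
  · intro K hK
    simp only [Set.mem_iUnion] at hK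
    obtain ⟨P, hP, Q, hQ, hK⟩ := hK
    exact (hR P Q hP hQ).2.1 K hK
  · have hc : ContinuousAt f x := hf.continuousOn.continuousAt (hu.mem_nhds hxu)
    filter_upwards [hSn, hc hTn] with y ⟨P, hP, hyP⟩ ⟨Q, hQ, hyQ⟩
    obtain ⟨K, hK, hyK⟩ := (hR P Q hP hQ).2.2 y hyP hyQ
    exact ⟨K, Set.mem_biUnion hP (Set.mem_biUnion hQ hK), hyK⟩

theorem isPLOn_id : IsPLOn (id : Cube n → Cube n) Set.univ := by
  refine ⟨continuousOn_id, fun x hx => ?_⟩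
  obtain ⟨T, hT, hTs, hTn⟩ := exists_simplices_nhds isOpen_univ hx
  exact ⟨T, hT, fun P hP => ⟨(hTs P hP).1, (hTs P hP).2, AffineMap.id ℝ _, fun _ _ => rfl⟩, hTn⟩

theorem IsPLOn.locality (hu : IsOpen u)
    (h : ∀ x ∈ u, ∃ v, IsOpen v ∧ x ∈ v ∧ IsPLOn f (u ∩ v)) : IsPLOn f u := by
  constructor
  · intro x hx
    obtain ⟨v, hv, hxv, hf⟩ := h x hx
    exact (hf.continuousOn.continuousAt ((hu.inter hv).mem_nhds ⟨hx, hxv⟩)).continuousWithinAt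
  · intro x hx
    obtain ⟨v, hv, hxv, hf⟩ := h x hx
    obtain ⟨T, hT, hTs, hTn⟩ := hf.exists_simplices x ⟨hx, hxv⟩
    exact ⟨T, hT, fun P hP => ⟨(hTs P hP).1,
      (hTs P hP).2.1.trans (Set.image_mono Set.inter_subset_left), (hTs P hP).2.2⟩, hTn⟩

theorem IsPLOn.congr (hfg : ∀ x ∈ u, g x = f x) (hf : IsPLOn f u) : IsPLOn g u := by
  refine ⟨hf.continuousOn.congr hfg, fun x hx => ?_⟩
  obtain ⟨T, hT, hTs, hTn⟩ := hf.exists_simplices x hx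
  refine ⟨T, hT, fun P hP => ⟨(hTs P hP).1, (hTs P hP).2.1, ?_⟩, hTn⟩
  obtain ⟨A, hA⟩ := (hTs P hP).2.2
  refine ⟨A, fun y hy => ?_⟩
  obtain ⟨z, hz, hzy⟩ := (hTs P hP).2.1 hy
  have : z = y := Subtype.ext hzy
  subst this
  rw [hfg z hz, hA z hy]

theorem eq_of_eqOn_isOpen {A B : (Fin n → ℝ) →ᵃ[ℝ] (Fin n → ℝ)} {W : Set (Fin n → ℝ)}
    (hW : IsOpen W) (hne : W.Nonempty) (h : Set.EqOn A B W) : A = B :=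
  AffineMap.ext_on (hW.affineSpan_eq_top hne) h

theorem IsOrientedPLOn.comp (hf : IsOrientedPLOn f u) (hg : IsOrientedPLOn g v) (hu : IsOpen u) :
    IsOrientedPLOn (g ∘ f) (u ∩ f ⁻¹' v) := by
  refine ⟨hf.toIsPLOn.comp hg.toIsPLOn hu, fun U hU hne hUs C hC => ?_⟩
  obtain ⟨V, hVU, hV, hVne, A, hA⟩ :=
    hf.toIsPLOn.exists_isOpen_affine hU hne (hUs.trans Set.inter_subset_left)
  have hdA := hf.det_pos V hV hVne (hVU.trans (hUs.trans Set.inter_subset_left)) A hA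
  obtain ⟨W, hW, ⟨w, hw⟩, hWV⟩ := exists_isOpen_subset_cube hV hVne
  have hbij : Function.Bijective A := by
    have : Function.Bijective A.linear :=
      (LinearMap.equivOfDetNeZero A.linear hdA.ne').bijective
    exact ⟨A.linear_injective_iff.1 this.1, A.linear_surjective_iff.1 this.2⟩
  have hAopen : IsOpenMap A := by
    rw [← AffineMap.isOpenMap_linear_iff]
    exact LinearMap.isOpenMap_of_finiteDimensional _ (A.linear_surjective_iff.2 hbij.2)
  -- the image of `W` is an open subset of the cube, contained in `v`
  let V' : Set (Cube n) := (fun y : Cube n => (y : Fin n → ℝ)) ⁻¹' (A '' W)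
  have hV' : IsOpen V' := (hAopen W hW).preimage continuous_subtype_val
  have hfV : ∀ y : Cube n, (y : Fin n → ℝ) ∈ W → y ∈ V := by
    intro y hy
    obtain ⟨z, hz, hzy⟩ := hWV hy
    rwa [← (Subtype.ext hzy : z = y)]
  have hV'v : V' ⊆ v := by
    rintro y ⟨z, hz, hzy⟩
    obtain ⟨z', hz', rfl⟩ := hWV hz
    have : f z' = y := Subtype.ext ((hA z' hz').trans hzy)
    rw [← this]
    exact (hUs (hVU hz')).2
  have hV'ne : V'.Nonempty := by
    obtain ⟨z, hz, hzw⟩ := hWV hw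
    refine ⟨f z, ?_⟩
    change (f z : Fin n → ℝ) ∈ A '' W
    rw [hA z hz, show (z : Fin n → ℝ) = w from hzw]
    exact ⟨w, hw, rfl⟩
  obtain ⟨Y, hYV, hY, hYne, B, hB⟩ := hg.toIsPLOn.exists_isOpen_affine hV' hV'ne hV'v
  have hdB := hg.det_pos Y hY hYne (hYV.trans hV'v) B hB
  obtain ⟨Z, hZ, ⟨z, hz⟩, hZY⟩ := exists_isOpen_subset_cube hY hYne
  have hCBA : C = B.comp A := by
    refine eq_of_eqOn_isOpen
      (hW.inter (hZ.preimage A.continuous_of_finiteDimensional)) ?_ ?_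
    · obtain ⟨y, hy, rfl⟩ := hZY hz
      obtain ⟨x, hx, hxy⟩ := hYV hy
      refine ⟨x, hx, ?_⟩
      rw [Set.mem_preimage, hxy]
      exact hz
    · rintro x ⟨hxW, hxZ⟩
      obtain ⟨x', hx', rfl⟩ := hWV hxW
      obtain ⟨y, hy, hyx⟩ := hZY hxZ
      have h1 : f x' = y := Subtype.ext ((hA x' hx').trans hyx.symm)
      rw [← hC x' (hVU hx'), Function.comp_apply, h1, hB y hy, AffineMap.comp_apply]
      exact congrArg B hyx
  rw [hCBA, AffineMap.comp_linear, LinearMap.det_comp]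
  exact mul_pos hdB hdA

theorem isOrientedPLOn_id : IsOrientedPLOn (id : Cube n → Cube n) Set.univ := by
  refine ⟨isPLOn_id, fun U hU hne _ A hA => ?_⟩
  obtain ⟨W, hW, hWne, hWU⟩ := exists_isOpen_subset_cube hU hne
  have : A = AffineMap.id ℝ _ := by
    refine eq_of_eqOn_isOpen hW hWne fun y hy => ?_
    obtain ⟨z, hz, rfl⟩ := hWU hy
    exact (hA z hz).symm
  rw [this]
  simp

theorem IsOrientedPLOn.locality (hu : IsOpen u)
    (h : ∀ x ∈ u, ∃ v, IsOpen v ∧ x ∈ v ∧ IsOrientedPLOn f (u ∩ v)) : IsOrientedPLOn f u := by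
  refine ⟨IsPLOn.locality hu fun x hx => ?_, fun U hU hne hUs A hA => ?_⟩
  · obtain ⟨v, hv, hxv, hf⟩ := h x hx
    exact ⟨v, hv, hxv, hf.toIsPLOn⟩
  · obtain ⟨x, hx⟩ := hne
    obtain ⟨v, hv, hxv, hf⟩ := h x (hUs hx)
    exact hf.det_pos (U ∩ v) (hU.inter hv) ⟨x, hx, hxv⟩ (Set.inter_subset_inter_left _ hUs) A
      fun y hy => hA y hy.1

theorem IsOrientedPLOn.congr (hfg : ∀ x ∈ u, g x = f x) (hf : IsOrientedPLOn f u) :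
    IsOrientedPLOn g u :=
  ⟨hf.toIsPLOn.congr hfg, fun U hU hne hUs A hA =>
    hf.det_pos U hU hne hUs A fun y hy => by rw [← hfg y (hUs hy), hA y hy]⟩

end Stability

/-- The pseudogroup of piecewise linear homeomorphisms between open subsets of `Iⁿ`
(the map and its inverse are piecewise linear). -/
def plGroupoid (n : ℕ) : StructureGroupoid (Cube n) :=
  Pregroupoid.groupoid
    { property := fun f s => IsPLOn f s
      comp := fun hf hg hu _ _ => hf.comp hg hu
      id_mem := isPLOn_id
      locality := fun hu h => IsPLOn.locality hu h
      congr := fun _ hfg hf => hf.congr hfg }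

/-- The pseudogroup of orientation preserving piecewise linear homeomorphisms between open subsets
of `Iⁿ`. -/
def orientedPLGroupoid (n : ℕ) : StructureGroupoid (Cube n) :=
  Pregroupoid.groupoid
    { property := fun f s => IsOrientedPLOn f s
      comp := fun hf hg hu _ _ => hf.comp hg hu
      id_mem := isOrientedPLOn_id
      locality := fun hu h => IsOrientedPLOn.locality hu h
      congr := fun _ hfg hf => hf.congr hfg }

/-- The automorphism group of a manifold `M` with a `G`-structure: all homeomorphisms of `M` that
belong to the pseudogroup `G` when read in charts. -/
def automorphismGroup {H : Type*} [TopologicalSpace H] (G : StructureGroupoid H)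
    (M : Type*) [TopologicalSpace M] [ChartedSpace H M] [HasGroupoid M G] :
    Subgroup (M ≃ₜ M) where
  carrier := {f | ∀ c ∈ atlas H M, ∀ c' ∈ atlas H M,
    c.symm ≫ₕ f.toOpenPartialHomeomorph ≫ₕ c' ∈ G}
  mul_mem' := fun {f g} hf hg c hc c' hc' =>
    (Structomorph.trans (⟨g, fun a b ha hb => hg a ha b hb⟩ : Structomorph G M M)
      (⟨f, fun a b ha hb => hf a ha b hb⟩ : Structomorph G M M)).mem_groupoid c c' hc hc'
  one_mem' := fun c hc c' hc' => (Structomorph.refl (G := G) M).mem_groupoid c c' hc hc'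
  inv_mem' := fun {f} hf c hc c' hc' =>
    (Structomorph.symm (⟨f, fun a b ha hb => hf a ha b hb⟩ : Structomorph G M M)).mem_groupoid
      c c' hc hc'

/-- The group `PL(M)` of piecewise linear homeomorphisms of a PL manifold `M`. -/
abbrev PL (n : ℕ) (M : Type*) [TopologicalSpace M] [ChartedSpace (Cube n) M]
    [HasGroupoid M (plGroupoid n)] : Subgroup (M ≃ₜ M) :=
  automorphismGroup (plGroupoid n) M

/-- The group of orientation preserving piecewise linear homeomorphisms of an oriented PL
manifold `M`. -/
abbrev OrientedPL (n : ℕ) (M : Type*) [TopologicalSpace M] [ChartedSpace (Cube n) M]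
    [HasGroupoid M (orientedPLGroupoid n)] : Subgroup (M ≃ₜ M) :=
  automorphismGroup (orientedPLGroupoid n) M

/-- The group `Γ` carries a topology that makes it a Polish topological group. -/
def AdmitsPolishGroupTopology (Γ : Type*) [Group Γ] : Prop :=
  ∃ τ : TopologicalSpace Γ, @IsTopologicalGroup Γ τ _ ∧ @PolishSpace Γ τ

end PLGroup

/-! Near a fixed point `p`, a piecewise linear map is affine on finitely many simplices containing
`p`, so it commutes near `p` with the homothety of ratio `1 / 2` about `p`
(`IsPLOn.eventually_midpoint`). At an interior point of a chart this homothety is the germ of an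
element `h` of the group itself (`exists_contraction`, `extendById`). Hence every `g` fixing `p`
commutes with `h` on a neighbourhood of `p` that depends on `g`. A Polish topology would make that
neighbourhood uniform on a nonempty open set, and the group is too flexible for this.

The topology is unknown, so closed sets must come from algebra: centralizers are closed in a
Hausdorff group, and commuting with all elements supported in an open set amounts, given enough
small supports, to fixing that set pointwise. Let `H` be the centralizer of the elements supported
on one side `L` of `p`; its elements fix `p`. By Baire, some nonempty open subset of `H` consists of
elements commuting with `h` on one fixed neighbourhood of `p`. Take `g₀` in it and a small open `N`
on the other side `R` with `h(N)` disjoint from `N`. If `u` is supported in `N` and `g₀ * u` stays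
in the open set, comparing the two commutation relations on `N` forces `u = 1`. So the elements
supported in `N` form a discrete, hence countable, subgroup; but pushing a point by different
amounts (`exists_push`) gives uncountably many. This is `not_admitsPolishGroupTopology_of_conical`.

All maps constructed preserve orientation, and only piecewise linearity of `g` is used, so one
argument serves every pseudogroup between the oriented and the full one. -/

namespace PLGroup

/-! ### Groups of homeomorphisms: supports, centralizers and the Baire argument. -/

section Abstract

variable {M : Type*} [TopologicalSpace M]

/-- The elements of `Γ` supported in `U`. -/
def supportedIn (Γ : Subgroup (M ≃ₜ M)) (U : Set M) : Subgroup Γ where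
  carrier := {g | ∀ x ∉ U, g.1 x = x}
  mul_mem' := fun {a b} ha hb x hx => by
    change a.1 (b.1 x) = x
    rw [hb x hx, ha x hx]
  one_mem' := fun _ _ => rfl
  inv_mem' := fun {a} ha x hx => by
    change a.1.symm x = x
    rw [Homeomorph.symm_apply_eq, ha x hx]

theorem map_mem_of_mem_supportedIn {Γ : Subgroup (M ≃ₜ M)} {U : Set M} {g : Γ}
    (hg : g ∈ supportedIn Γ U) {x : M} (hx : x ∈ U) : g.1 x ∈ U := by
  by_contra h
  have h1 := hg _ h
  exact h (by rwa [g.1.injective h1])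

theorem mul_val_apply {Γ : Subgroup (M ≃ₜ M)} (a b : Γ) (x : M) : (a * b).1 x = a.1 (b.1 x) := rfl

theorem inv_val_apply_eq {Γ : Subgroup (M ≃ₜ M)} (a : Γ) {x y : M} :
    (a⁻¹).1 x = y ↔ x = a.1 y := Homeomorph.symm_apply_eq a.1

/-- A homeomorphism which is the identity on `U` commutes with those supported in `U`. -/
theorem commute_of_fixes {Γ : Subgroup (M ≃ₜ M)} {U : Set M} {g s : Γ}
    (hg : ∀ x ∈ U, g.1 x = x) (hs : s ∈ supportedIn Γ U) : s * g = g * s := by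
  ext x
  change s.1 (g.1 x) = g.1 (s.1 x)
  by_cases hx : x ∈ U
  · rw [hg x hx, hg _ (map_mem_of_mem_supportedIn hs hx)]
  · rw [hs x hx]
    refine hs _ fun h => hx ?_
    have := g.1.injective (hg _ h)
    rwa [this] at h

/-- If there are elements of `Γ` with arbitrarily small support moving the point `x ∈ U`, then the
centralizer of the elements supported in `U` fixes `x`. -/
theorem fixes_of_commute [T2Space M] {Γ : Subgroup (M ≃ₜ M)} {U : Set M} {x : M} (hU : U ∈ 𝓝 x)
    (hx : ∀ N ∈ 𝓝 x, ∃ s ∈ supportedIn Γ N, s.1 x ≠ x) {g : Γ}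
    (hg : ∀ s ∈ supportedIn Γ U, s * g = g * s) : g.1 x = x := by
  by_contra hne
  obtain ⟨A, B, hA, hB, hgA, hxB, hAB⟩ := t2_separation hne
  obtain ⟨s, hs, hsx⟩ := hx (U ∩ B) (Filter.inter_mem hU (hB.mem_nhds hxB))
  have h1 : (s * g).1 x = (g * s).1 x := by
    rw [hg s fun y hy => hs y fun h => hy h.1]
  rw [mul_val_apply, mul_val_apply, hs (g.1 x)
    fun h => Set.disjoint_left.1 hAB hgA h.2] at h1
  exact hsx (g.1.injective h1).symm

/-- A group of homeomorphisms with enough elements of small support near a point `p`, and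
containing an element `h` without other fixed points near `p` that commutes near `p` with every
element fixing `p`, has no Polish group topology. -/
theorem not_admitsPolishGroupTopology_of_conical [T2Space M] (Γ : Subgroup (M ≃ₜ M)) (p : M)
    [(𝓝 p).IsCountablyGenerated] (h : Γ)
    (hcomm : ∀ g : Γ, g.1 p = p → ∀ᶠ x in 𝓝 p, g.1 (h.1 x) = h.1 (g.1 x))
    {O L R : Set M} (hO : IsOpen O) (hp : p ∈ O) (hL : IsOpen L) (hR : IsOpen R)
    (hLR : Disjoint L R) (hpL : p ∈ closure L) (hpR : p ∈ closure R)
    (hmove : ∀ᶠ x in 𝓝 p, x ∈ R → h.1 x ≠ x)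
    (hrich : ∀ x ∈ O, ∀ N ∈ 𝓝 x, ∃ S : Set Γ, ¬ S.Countable ∧ S ⊆ supportedIn Γ N ∧
      S.InjOn fun s => s.1 x) :
    ¬ AdmitsPolishGroupTopology Γ := by
  rintro ⟨τ, hτ, hP⟩
  have hsmall : ∀ x ∈ O, ∀ N ∈ 𝓝 x, ∃ s ∈ supportedIn Γ N, s.1 x ≠ x := by
    intro x hx N hN
    obtain ⟨S, hS, hSN, hinj⟩ := hrich x hx N hN
    by_contra hcon
    push Not at hcon
    refine hS (Set.Subsingleton.countable fun a ha b hb => hinj ha hb ?_)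
    change a.1 x = b.1 x
    rw [hcon a (hSN ha), hcon b (hSN hb)]
  -- Such a `g` fixes `L ∩ O` pointwise, and `p` lies in the closure of that set.
  have hfix : ∀ g : Γ, g ∈ Subgroup.centralizer (supportedIn Γ L : Set Γ) → g.1 p = p := by
    intro g hg
    have hcl : IsClosed {x | g.1 x = x} := isClosed_eq g.1.continuous continuous_id
    have hsub : L ∩ O ⊆ {x | g.1 x = x} := fun x hx =>
      fixes_of_commute (hL.mem_nhds hx.1) (hsmall x hx.2) (Subgroup.mem_centralizer_iff.1 hg)
    have hpc : p ∈ closure (L ∩ O) := by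
      rw [inter_comm]
      exact hO.inter_closure ⟨hp, hpL⟩
    exact hcl.closure_subset_iff.2 hsub hpc
  set H := Subgroup.centralizer (supportedIn Γ L : Set Γ) with hHdef
  have hHcl : IsClosed (H : Set Γ) := Set.isClosed_centralizer _
  have : PolishSpace H := hHcl.polishSpace
  obtain ⟨B, hB⟩ := (𝓝 p).exists_antitone_basis
  -- That `g` commutes with `h` on `B k` is encoded by a centralizer condition on a commutator,
  -- which is closed for any Hausdorff group topology.
  let A : ℕ → Set H := fun k =>
    {g | g.1⁻¹ * h⁻¹ * g.1 * h ∈ Subgroup.centralizer (supportedIn Γ (B k) : Set Γ)}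
  have hAcl : ∀ k, IsClosed (A k) := fun k =>
    (Set.isClosed_centralizer (supportedIn Γ (B k) : Set Γ)).preimage
      (f := fun g : H => g.1⁻¹ * h⁻¹ * g.1 * h) (by fun_prop)
  have hcomp : ∀ (g : Γ) (x : M), (g⁻¹ * h⁻¹ * g * h).1 x = x ↔ g.1 (h.1 x) = h.1 (g.1 x) := by
    intro g x
    rw [mul_assoc, mul_assoc, mul_val_apply, inv_val_apply_eq, mul_val_apply, inv_val_apply_eq,
      mul_val_apply]
  have hAun : ⋃ k, A k = univ := by
    refine eq_univ_of_forall fun g => ?_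
    obtain ⟨k, hk⟩ := hB.mem_iff.1 (hcomm g.1 (hfix g.1 g.2))
    refine mem_iUnion.2 ⟨k, Subgroup.mem_centralizer_iff.2 fun s hs => commute_of_fixes ?_ hs⟩
    exact fun x hx => (hcomp g.1 x).2 (hk hx)
  obtain ⟨k, g₀, hg₀⟩ := nonempty_interior_of_iUnion_of_closed hAcl hAun
  have hAfix : ∀ g ∈ A k, ∀ x ∈ interior (B k) ∩ O, g.1.1 (h.1 x) = h.1 (g.1.1 x) := by
    intro g hg x hx
    exact (hcomp g.1 x).1 (fixes_of_commute (mem_interior_iff_mem_nhds.1 hx.1) (hsmall x hx.2)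
      (Subgroup.mem_centralizer_iff.1 hg))
  obtain ⟨y, hyR, hyB, hyO, hyh⟩ : ∃ y ∈ R, y ∈ interior (B k) ∧ y ∈ O ∧ h.1 y ≠ y := by
    have h1 : ∀ᶠ x in 𝓝 p, x ∈ interior (B k) ∧ x ∈ O ∧ (x ∈ R → h.1 x ≠ x) := by
      filter_upwards [interior_mem_nhds.2 (hB.mem k), hO.mem_nhds hp, hmove] with x h1 h2 h3
      exact ⟨h1, h2, h3⟩
    obtain ⟨y, hy, hyR⟩ := ((mem_closure_iff_frequently.1 hpR).and_eventually h1).exists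
    exact ⟨y, hy, hyR.1, hyR.2.1, hyR.2.2 hy⟩
  obtain ⟨C, D, hC, hD, hyC, hyD, hCD⟩ := t2_separation hyh
  -- `h` maps `N` into `C`, hence off `N`; and `N ⊆ R` is disjoint from `L`, so elements supported
  -- in `N` belong to `H`.
  set N : Set M := (D ∩ h.1 ⁻¹' C) ∩ (R ∩ (interior (B k) ∩ O)) with hN
  have hNy : N ∈ 𝓝 y := by
    refine IsOpen.mem_nhds ?_ ⟨⟨hyD, hyC⟩, hyR, hyB, hyO⟩
    exact (hD.inter (hC.preimage h.1.continuous)).inter (hR.inter (isOpen_interior.inter hO))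
  have hNH : ∀ s ∈ supportedIn Γ N, s ∈ H := by
    intro s hs
    refine Subgroup.mem_centralizer_iff.2 fun t ht => commute_of_fixes (fun x hx => hs x ?_) ht
    exact fun hxN => Set.disjoint_left.1 hLR hx hxN.2.1
  obtain ⟨S, hS, hSN, -⟩ := hrich y hyO N hNy
  -- On `N`, `u` fixes `h x`, so `h (g₀ (u x)) = g₀ (u (h x)) = g₀ (h x) = h (g₀ x)`, and
  -- injectivity gives `u x = x`.
  have htriv : ∀ u : H, u.1 ∈ supportedIn Γ N → g₀ * u ∈ interior (A k) → u = 1 := by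
    intro u hu hgu
    refine Subtype.ext (Subtype.ext (Homeomorph.ext fun x => ?_))
    change u.1.1 x = x
    by_cases hx : x ∈ N
    · have h1 := hAfix _ (interior_subset hg₀) x hx.2.2
      have h2 := hAfix _ (interior_subset hgu) x hx.2.2
      change g₀.1.1 (u.1.1 (h.1 x)) = h.1 (g₀.1.1 (u.1.1 x)) at h2
      rw [hu (h.1 x) fun hh => Set.disjoint_left.1 hCD hx.1.2 hh.1.1, h1] at h2
      exact (g₀.1.1.injective (h.1.injective h2)).symm
    · exact hu x hx
  let V : Subgroup H := (supportedIn Γ N).comap H.subtype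
  have hdisc : DiscreteTopology V := by
    refine discreteTopology_of_isOpen_singleton_one ?_
    have : ({1} : Set V) = (fun v : V => g₀ * v.1) ⁻¹' interior (A k) := by
      ext v
      constructor
      · rintro rfl
        simpa using hg₀
      · intro hv
        exact Subtype.ext (htriv v.1 v.2 hv)
    rw [this]
    exact isOpen_interior.preimage (by fun_prop)
  -- A subspace of a Polish space is separable, and a discrete separable space is countable.
  have hcount : Countable V := TopologicalSpace.separableSpace_iff_countable.1 inferInstance
  apply hS
  have : S ⊆ Set.range fun v : V => v.1.1 := fun s hs => ⟨⟨⟨s, hNH s (hSN hs)⟩, hSN hs⟩, rfl⟩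
  exact (Set.countable_range _).mono this

end Abstract

/-! ### Extending compactly supported maps of the model space to the manifold. -/

section Extension

variable {H M : Type*} [TopologicalSpace H] [TopologicalSpace M]

open Classical in
/-- The extension by the identity of a self-map of the model space, read in the chart `e`. -/
noncomputable def extendByIdFun (e : OpenPartialHomeomorph M H) (F : H → H) (x : M) : M :=
  if x ∈ e.source then e.symm (F (e x)) else x

variable {e : OpenPartialHomeomorph M H} {K : Set H}

theorem mapsTo_target {F : H ≃ₜ H} (hK : K ⊆ e.target) (hF : ∀ y ∉ K, F y = y) {y : H}
    (hy : y ∈ e.target) : F y ∈ e.target := by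
  by_contra h
  have h1 := F.injective (hF _ fun hh => h (hK hh))
  exact h (by rwa [h1])

theorem extendByIdFun_of_mem (F : H → H) {x : M} (hx : x ∈ e.source) :
    extendByIdFun e F x = e.symm (F (e x)) := if_pos hx

theorem extendByIdFun_of_notMem_image {F : H → H} (hF : ∀ y ∉ K, F y = y) {x : M}
    (hx : x ∉ e.symm '' K) : extendByIdFun e F x = x := by
  by_cases h : x ∈ e.source
  · rw [extendByIdFun_of_mem F h, hF, e.left_inv h]
    exact fun hk => hx ⟨_, hk, e.left_inv h⟩
  · exact if_neg h

theorem symm_fixes {F : H ≃ₜ H} (hF : ∀ y ∉ K, F y = y) : ∀ y ∉ K, F.symm y = y :=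
  fun y hy => by rw [Homeomorph.symm_apply_eq, hF y hy]

theorem extendByIdFun_leftInverse {F : H ≃ₜ H} (hK : K ⊆ e.target) (hF : ∀ y ∉ K, F y = y) :
    Function.LeftInverse (extendByIdFun e F.symm) (extendByIdFun e F) := by
  intro x
  by_cases h : x ∈ e.source
  · have h1 := mapsTo_target hK hF (e.map_source h)
    rw [extendByIdFun_of_mem F h, extendByIdFun_of_mem _ (e.map_target h1), e.right_inv h1,
      F.symm_apply_apply, e.left_inv h]
  · have h2 : ∀ F : H → H, extendByIdFun e F x = x := fun F => if_neg h
    rw [h2, h2]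

/-- Compactness of `K` and the Hausdorff property make `e.symm '' K` closed, so `M` is covered by
two open sets: the chart domain, and the complement of that image, where the map is the identity. -/
theorem continuous_extendByIdFun [T2Space M] {F : H ≃ₜ H} (hKc : IsCompact K) (hK : K ⊆ e.target)
    (hF : ∀ y ∉ K, F y = y) : Continuous (extendByIdFun e F) := by
  have hS : IsClosed (e.symm '' K) :=
    (hKc.image_of_continuousOn (e.symm.continuousOn.mono hK)).isClosed
  refine continuous_iff_continuousAt.2 fun x => ?_
  by_cases h : x ∈ e.source
  · have h1 : ContinuousAt (fun x => e.symm (F (e x))) x := by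
      refine ContinuousAt.comp (g := e.symm) (f := fun x => F (e x)) ?_ ?_
      · exact e.symm.continuousAt (mapsTo_target hK hF (e.map_source h))
      · exact F.continuous.continuousAt.comp (e.continuousAt h)
    refine h1.congr ?_
    filter_upwards [e.open_source.mem_nhds h] with y hy
    exact (extendByIdFun_of_mem F hy).symm
  · refine continuousAt_id.congr ?_
    have : x ∉ e.symm '' K := by
      rintro ⟨y, hy, rfl⟩
      exact h (e.map_target (hK hy))
    filter_upwards [hS.isOpen_compl.mem_nhds this] with y hy
    exact (extendByIdFun_of_notMem_image hF hy).symm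

/-- The extension by the identity of a self-homeomorphism of the model space which is compactly
supported in the target of the chart `e`. -/
noncomputable def extendById [T2Space M] (e : OpenPartialHomeomorph M H) (F : H ≃ₜ H)
    (hKc : IsCompact K) (hK : K ⊆ e.target) (hF : ∀ y ∉ K, F y = y) : M ≃ₜ M where
  toFun := extendByIdFun e F
  invFun := extendByIdFun e F.symm
  left_inv := extendByIdFun_leftInverse hK hF
  right_inv := extendByIdFun_leftInverse (F := F.symm) hK (symm_fixes hF)
  continuous_toFun := continuous_extendByIdFun hKc hK hF
  continuous_invFun := continuous_extendByIdFun hKc hK (symm_fixes hF)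

/-- Membership in `G` is local. Over the source of `e` the map is a composite of transition maps
with `F`; off `e.symm '' K` it is a restricted transition map. -/
theorem extendById_mem_automorphismGroup [T2Space M] [ChartedSpace H M] (G : StructureGroupoid H)
    [ClosedUnderRestriction G] [HasGroupoid M G] (he : e ∈ atlas H M) {F : H ≃ₜ H}
    (hKc : IsCompact K) (hK : K ⊆ e.target) (hF : ∀ y ∉ K, F y = y)
    (hFG : F.toOpenPartialHomeomorph ∈ G) :
    extendById e F hKc hK hF ∈ automorphismGroup G M := by
  set f := extendById e F hKc hK hF with hf
  have hfx : ∀ x ∈ e.source, f x = e.symm (F (e x)) := fun x hx => extendByIdFun_of_mem F hx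
  have hS : IsClosed (e.symm '' K) :=
    (hKc.image_of_continuousOn (e.symm.continuousOn.mono hK)).isClosed
  have hfS : ∀ x ∉ e.symm '' K, f x = x := fun x hx => extendByIdFun_of_notMem_image hF hx
  intro c hc c' hc'
  refine G.locality fun x hx => ?_
  by_cases h : c.symm x ∈ e.source
  · have ho : IsOpen (c.target ∩ c.symm ⁻¹' e.source) :=
      c.symm.isOpen_inter_preimage e.open_source
    have hx1 : x ∈ c.target := by simpa using hx.1
    refine ⟨_, ho, ⟨hx1, h⟩, ?_⟩
    have h1 : (c.symm ≫ₕ e) ≫ₕ F.toOpenPartialHomeomorph ≫ₕ (e.symm ≫ₕ c') ∈ G :=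
      G.trans (G.compatible hc he) (G.trans hFG (G.compatible he hc'))
    refine G.mem_of_eqOnSource h1 ⟨?_, ?_⟩
    · ext y
      simp only [ho.interior_eq, mem_inter_iff, mfld_simps,
        mem_preimage, Function.comp_apply, Homeomorph.toOpenPartialHomeomorph_apply,
        Homeomorph.toOpenPartialHomeomorph_source]
      constructor
      · rintro ⟨⟨h1, h2⟩, -, h3⟩
        rw [hfx _ h3] at h2
        exact ⟨⟨h1, h3⟩, mapsTo_target hK hF (e.map_source h3), h2⟩
      · rintro ⟨⟨h1, h3⟩, -, h2⟩
        rw [← hfx _ h3] at h2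
        exact ⟨⟨h1, h2⟩, h1, h3⟩
    · intro y hy
      have hy2 : c.symm y ∈ e.source := by
        rw [OpenPartialHomeomorph.restr_source, ho.interior_eq] at hy
        exact hy.2.2
      change c' (f (c.symm y)) = c' (e.symm (F (e (c.symm y))))
      rw [hfx _ hy2]
  · have ho : IsOpen (c.target ∩ c.symm ⁻¹' (e.symm '' K)ᶜ) :=
      c.symm.isOpen_inter_preimage hS.isOpen_compl
    have hx1 : x ∈ c.target := by simpa using hx.1
    have hxS : c.symm x ∉ e.symm '' K := by
      rintro ⟨y, hy, hyx⟩
      exact h (hyx ▸ e.map_target (hK hy))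
    refine ⟨_, ho, ⟨hx1, hxS⟩, ?_⟩
    refine G.mem_of_eqOnSource (closedUnderRestriction' (G.compatible hc hc') ho) ⟨?_, ?_⟩
    · ext y
      simp only [ho.interior_eq, mem_inter_iff, mfld_simps,
        mem_preimage, Homeomorph.toOpenPartialHomeomorph_apply, mem_compl_iff]
      constructor
      · rintro ⟨⟨h1, h2⟩, -, h3⟩
        rw [hfS _ h3] at h2
        exact ⟨⟨h1, h2⟩, h1, h3⟩
      · rintro ⟨⟨h1, h2⟩, -, h3⟩
        rw [← hfS _ h3] at h2
        exact ⟨⟨h1, h2⟩, h1, h3⟩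
    · intro y hy
      have hy2 : c.symm y ∉ e.symm '' K := by
        rw [OpenPartialHomeomorph.restr_source, ho.interior_eq] at hy
        exact hy.2.2
      change c' (f (c.symm y)) = c' (c.symm y)
      rw [hfS _ hy2]

end Extension

/-! ### The two piecewise linear pseudogroups and restriction. -/

section Groupoids

variable {n : ℕ}

theorem isOrientedPLOn_id_of_isOpen {s : Set (Cube n)} (hs : IsOpen s) :
    IsOrientedPLOn (id : Cube n → Cube n) s := by
  refine ⟨⟨continuousOn_id, fun x hx => ?_⟩, fun U hU hne _ A hA => ?_⟩
  · obtain ⟨T, hT, hTs, hTn⟩ := exists_simplices_nhds hs hx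
    exact ⟨T, hT, fun P hP => ⟨(hTs P hP).1, (hTs P hP).2, AffineMap.id ℝ _, fun _ _ => rfl⟩, hTn⟩
  · exact isOrientedPLOn_id.det_pos U hU hne (subset_univ _) A hA

theorem orientedPLGroupoid_le_plGroupoid : orientedPLGroupoid n ≤ plGroupoid n := by
  rintro e ⟨h1, h2⟩
  exact ⟨h1.toIsPLOn, h2.toIsPLOn⟩

theorem closedUnderRestriction_of_orientedPLGroupoid_le {G : StructureGroupoid (Cube n)}
    (hG : orientedPLGroupoid n ≤ G) : ClosedUnderRestriction G := by
  refine (closedUnderRestriction_iff_id_le G).2 (le_trans ?_ hG)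
  rintro e ⟨s, hs, he⟩
  exact (orientedPLGroupoid n).mem_of_eqOnSource
    (e := OpenPartialHomeomorph.ofSet s hs)
    ⟨isOrientedPLOn_id_of_isOpen hs, isOrientedPLOn_id_of_isOpen hs⟩ he

end Groupoids

/-! ### Piecewise affine functions and maps on finite polyhedral covers. -/

section Polyhedra

variable {n : ℕ}

/-- A finite intersection of closed half-spaces. -/
def IsPolyhedron (K : Set (Fin n → ℝ)) : Prop :=
  ∃ (ι : Type) (_ : Finite ι) (L : ι → ((Fin n → ℝ) →ᵃ[ℝ] ℝ)), K = {x | ∀ i, 0 ≤ L i x}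

theorem isPolyhedron_univ : IsPolyhedron (univ : Set (Fin n → ℝ)) :=
  ⟨Empty, inferInstance, Empty.elim, by ext; simp⟩

theorem isPolyhedron_le (a b : (Fin n → ℝ) →ᵃ[ℝ] ℝ) : IsPolyhedron {x | a x ≤ b x} :=
  ⟨Unit, inferInstance, fun _ => b - a, by ext; simp⟩

theorem IsPolyhedron.inter {K K' : Set (Fin n → ℝ)} (h : IsPolyhedron K) (h' : IsPolyhedron K') :
    IsPolyhedron (K ∩ K') := by
  obtain ⟨ι, _, L, rfl⟩ := h
  obtain ⟨κ, _, L', rfl⟩ := h'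
  exact ⟨ι ⊕ κ, inferInstance, Sum.elim L L', by ext; simp⟩

theorem IsPolyhedron.preimage {K : Set (Fin n → ℝ)} (h : IsPolyhedron K)
    (A : (Fin n → ℝ) →ᵃ[ℝ] (Fin n → ℝ)) : IsPolyhedron (A ⁻¹' K) := by
  obtain ⟨ι, hι, L, rfl⟩ := h
  exact ⟨ι, hι, fun i => (L i).comp A, by ext; simp⟩

theorem IsPolyhedron.isClosed {K : Set (Fin n → ℝ)} (h : IsPolyhedron K) : IsClosed K := by
  obtain ⟨ι, _, L, rfl⟩ := h
  simp only [ofPred_forall]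
  exact isClosed_iInter fun i =>
    isClosed_le continuous_const (L i).continuous_of_finiteDimensional

theorem isPolyhedron_Icc : IsPolyhedron (Icc (0 : Fin n → ℝ) 1) := by
  refine ⟨Fin n ⊕ Fin n, inferInstance, Sum.elim (fun i => (LinearMap.proj i).toAffineMap)
    (fun i => AffineMap.const ℝ _ 1 - (LinearMap.proj i).toAffineMap), ?_⟩
  ext x
  simp [Pi.le_def]

/-- `ψ` agrees on each of finitely many polyhedra covering `ℝⁿ` with an affine function whose
slope in the direction `v` is at most `1 / 2`. -/
def IsPiecewiseAffine (v : Fin n → ℝ) (ψ : (Fin n → ℝ) → ℝ) : Prop :=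
  ∃ T : Set (Set (Fin n → ℝ) × ((Fin n → ℝ) →ᵃ[ℝ] ℝ)), T.Finite ∧
    (∀ q ∈ T, IsPolyhedron q.1 ∧ |q.2.linear v| ≤ 1 / 2 ∧ ∀ x ∈ q.1, ψ x = q.2 x) ∧
    ∀ x, ∃ q ∈ T, x ∈ q.1

theorem isPiecewiseAffine_affineMap {v : Fin n → ℝ} (a : (Fin n → ℝ) →ᵃ[ℝ] ℝ)
    (ha : |a.linear v| ≤ 1 / 2) : IsPiecewiseAffine v a :=
  ⟨{(univ, a)}, finite_singleton _, by simp [isPolyhedron_univ] at ha ⊢; exact ha, by simp⟩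

theorem IsPiecewiseAffine.const_sub {v : Fin n → ℝ} {ψ : (Fin n → ℝ) → ℝ}
    (h : IsPiecewiseAffine v ψ) (c : ℝ) : IsPiecewiseAffine v fun x => c - ψ x := by
  obtain ⟨T, hT, hq, hc⟩ := h
  refine ⟨(fun q => (q.1, AffineMap.const ℝ _ c - q.2)) '' T, hT.image _, ?_, fun x => ?_⟩
  · rintro _ ⟨q, hqT, rfl⟩
    obtain ⟨h1, h2, h3⟩ := hq q hqT
    exact ⟨h1, by simpa using h2, fun x hx => by simp [h3 x hx]⟩
  · obtain ⟨q, hqT, hx⟩ := hc x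
    exact ⟨_, ⟨q, hqT, rfl⟩, hx⟩

/-- Cut each intersection of two pieces by the half-space where one affine function dominates the
other. Each new piece keeps one of the old functions, so the slope bound survives. -/
theorem IsPiecewiseAffine.sup {v : Fin n → ℝ} {φ ψ : (Fin n → ℝ) → ℝ}
    (h : IsPiecewiseAffine v φ) (h' : IsPiecewiseAffine v ψ) : IsPiecewiseAffine v (φ ⊔ ψ) := by
  obtain ⟨T, hT, hq, hc⟩ := h
  obtain ⟨T', hT', hq', hc'⟩ := h'
  refine ⟨Set.image2 (fun q q' => ((q.1 ∩ q'.1) ∩ {x | q'.2 x ≤ q.2 x}, q.2)) T T' ∪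
    Set.image2 (fun q q' => ((q.1 ∩ q'.1) ∩ {x | q.2 x ≤ q'.2 x}, q'.2)) T T',
    (hT.image2 _ hT').union (hT.image2 _ hT'), ?_, fun x => ?_⟩
  · rintro _ (⟨q, hqT, q', hqT', rfl⟩ | ⟨q, hqT, q', hqT', rfl⟩)
    · obtain ⟨h1, h2, h3⟩ := hq q hqT
      obtain ⟨h1', h2', h3'⟩ := hq' q' hqT'
      refine ⟨(h1.inter h1').inter (isPolyhedron_le _ _), h2, fun x hx => ?_⟩
      rw [Pi.sup_apply, h3 x hx.1.1, h3' x hx.1.2]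
      exact max_eq_left hx.2
    · obtain ⟨h1, h2, h3⟩ := hq q hqT
      obtain ⟨h1', h2', h3'⟩ := hq' q' hqT'
      refine ⟨(h1.inter h1').inter (isPolyhedron_le _ _), h2', fun x hx => ?_⟩
      rw [Pi.sup_apply, h3 x hx.1.1, h3' x hx.1.2]
      exact max_eq_right hx.2
  · obtain ⟨q, hqT, hx⟩ := hc x
    obtain ⟨q', hqT', hx'⟩ := hc' x
    rcases le_total (q'.2 x) (q.2 x) with hle | hle
    · exact ⟨_, Or.inl ⟨q, hqT, q', hqT', rfl⟩, ⟨hx, hx'⟩, hle⟩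
    · exact ⟨_, Or.inr ⟨q, hqT, q', hqT', rfl⟩, ⟨hx, hx'⟩, hle⟩

/-- `F` agrees on each of finitely many polyhedra covering `ℝⁿ` with an orientation preserving
affine automorphism. -/
def IsPiecewiseAffineEquiv (F : (Fin n → ℝ) → (Fin n → ℝ)) : Prop :=
  ∃ T : Set (Set (Fin n → ℝ) × ((Fin n → ℝ) ≃ᵃ[ℝ] (Fin n → ℝ))), T.Finite ∧
    (∀ q ∈ T, IsPolyhedron q.1 ∧ 0 < LinearMap.det (q.2 : (Fin n → ℝ) →ᵃ[ℝ] (Fin n → ℝ)).linear ∧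
      ∀ x ∈ q.1, F x = q.2 x) ∧
    ∀ x, ∃ q ∈ T, x ∈ q.1

theorem IsPiecewiseAffineEquiv.symm {F : (Fin n → ℝ) ≃ (Fin n → ℝ)}
    (h : IsPiecewiseAffineEquiv F) : IsPiecewiseAffineEquiv F.symm := by
  obtain ⟨T, hT, hq, hc⟩ := h
  refine ⟨(fun q => (q.2.symm ⁻¹' q.1, q.2.symm)) '' T, hT.image _, ?_, fun x => ?_⟩
  · rintro _ ⟨q, hqT, rfl⟩
    obtain ⟨h1, h2, h3⟩ := hq q hqT
    refine ⟨h1.preimage (q.2.symm : (Fin n → ℝ) →ᵃ[ℝ] (Fin n → ℝ)), ?_, fun x hx => ?_⟩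
    · have h4 := q.2.linear.det_mul_det_symm
      have h5 : 0 < LinearMap.det (q.2.linear : (Fin n → ℝ) →ₗ[ℝ] (Fin n → ℝ)) := h2
      exact pos_of_mul_pos_right (zero_lt_one.trans_eq h4.symm) h5.le
    · rw [Equiv.symm_apply_eq, h3 _ hx]
      exact (q.2.apply_symm_apply x).symm
  · obtain ⟨q, hqT, hx⟩ := hc (F.symm x)
    refine ⟨_, ⟨q, hqT, rfl⟩, ?_⟩
    have h3 := (hq q hqT).2.2 _ hx
    rw [F.apply_symm_apply] at h3
    change q.2.symm x ∈ q.1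
    rwa [h3, q.2.symm_apply_apply]

theorem IsPiecewiseAffineEquiv.isOrientedPLOn {F : (Fin n → ℝ) → (Fin n → ℝ)}
    (h : IsPiecewiseAffineEquiv F) {f : Cube n → Cube n} (hf : Continuous f)
    (hfF : ∀ y : Cube n, (f y : Fin n → ℝ) = F y) : IsOrientedPLOn f univ := by
  obtain ⟨T, hT, hq, hc⟩ := h
  have hex : ∀ q ∈ T, ∃ S : Set (Set (Fin n → ℝ)), S.Finite ∧ (∀ P ∈ S, IsSimplex P) ∧
      ⋃₀ S = Icc (0 : Fin n → ℝ) 1 ∩ q.1 := by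
    intro q hqT
    have hcpt : IsCompact (Icc (0 : Fin n → ℝ) 1 ∩ q.1) :=
      isCompact_Icc.inter_right (hq q hqT).1.isClosed
    obtain ⟨ι, _, L, hL⟩ := isPolyhedron_Icc.inter (hq q hqT).1
    rw [hL] at hcpt ⊢
    exact exists_simplices_of_halfspaces L hcpt
  choose! S hSfin hSs hSu using hex
  refine ⟨⟨hf.continuousOn, fun x _ => ⟨⋃ q ∈ T, S q, hT.biUnion hSfin, ?_, ?_⟩⟩, ?_⟩
  · intro P hP
    simp only [mem_iUnion] at hP
    obtain ⟨q, hqT, hP⟩ := hP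
    have hPsub : P ⊆ Icc (0 : Fin n → ℝ) 1 ∩ q.1 := by
      rw [← hSu q hqT]
      exact subset_sUnion_of_mem hP
    refine ⟨hSs q hqT P hP, fun y hy => ⟨⟨y, (hPsub hy).1⟩, trivial, rfl⟩,
      (q.2 : (Fin n → ℝ) →ᵃ[ℝ] (Fin n → ℝ)), fun y hy => ?_⟩
    rw [hfF, (hq q hqT).2.2 _ (hPsub hy).2]
    rfl
  · refine Filter.univ_mem' fun y => ?_
    obtain ⟨q, hqT, hy⟩ := hc y
    have : (y : Fin n → ℝ) ∈ ⋃₀ S q := by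
      rw [hSu q hqT]
      exact ⟨y.2, hy⟩
    obtain ⟨P, hP, hyP⟩ := this
    exact ⟨P, mem_biUnion hqT hP, hyP⟩
  · intro U hU hne _ A hA
    obtain ⟨W, hW, hWne, hWU⟩ := exists_isOpen_subset_cube hU hne
    -- Finitely many closed pieces cover the space, so their interiors are dense (Baire). Hence `A`
    -- agrees on a nonempty open set with one of the given affine maps, and therefore equals it.
    have hd : Dense (⋃ q ∈ T, interior q.1) := by
      refine dense_biUnion_interior_of_closed (fun q hqT => (hq q hqT).1.isClosed) hT.countable ?_
      refine eq_univ_of_forall fun x => ?_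
      obtain ⟨q, hqT, hx⟩ := hc x
      exact mem_biUnion hqT hx
    obtain ⟨z, hzW, hz⟩ := hd.inter_open_nonempty W hW hWne
    simp only [mem_iUnion] at hz
    obtain ⟨q, hqT, hz⟩ := hz
    have : A = (q.2 : (Fin n → ℝ) →ᵃ[ℝ] (Fin n → ℝ)) := by
      refine eq_of_eqOn_isOpen (hW.inter isOpen_interior) ⟨z, hzW, hz⟩ fun x hx => ?_
      obtain ⟨y, hy, rfl⟩ := hWU hx.1
      change A (y : Fin n → ℝ) = q.2 (y : Fin n → ℝ)
      rw [← hA y hy, hfF, (hq q hqT).2.2 _ (interior_subset hx.2)]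
    rw [this]
    exact (hq q hqT).2.1

/-- On each piece the linear part is a transvection, with determinant one plus the slope along `v`.
The slope bound keeps this at least `1 / 2`, hence positive. -/
theorem IsPiecewiseAffine.shear {v : Fin n → ℝ} {ψ : (Fin n → ℝ) → ℝ}
    (h : IsPiecewiseAffine v ψ) : IsPiecewiseAffineEquiv fun x => x + ψ x • v := by
  obtain ⟨T, hT, hq, hc⟩ := h
  have hex : ∀ q ∈ T, ∃ B : (Fin n → ℝ) ≃ᵃ[ℝ] (Fin n → ℝ),
      0 < LinearMap.det (B : (Fin n → ℝ) →ᵃ[ℝ] (Fin n → ℝ)).linear ∧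
      ∀ x, B x = x + q.2 x • v := by
    intro q hqT
    let A : (Fin n → ℝ) →ᵃ[ℝ] (Fin n → ℝ) :=
      AffineMap.id ℝ _ + (LinearMap.toSpanSingleton ℝ _ v).toAffineMap.comp q.2
    have hlin : A.linear = LinearMap.transvection q.2.linear v := by
      ext1 x
      rfl
    have hdet : 0 < LinearMap.det A.linear := by
      rw [hlin, LinearMap.transvection.det]
      linarith [(abs_le.1 (hq q hqT).2.1).1]
    have hbij : Function.Bijective A := by
      have : Function.Bijective A.linear :=
        (LinearMap.equivOfDetNeZero A.linear hdet.ne').bijective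
      exact ⟨A.linear_injective_iff.1 this.1, A.linear_surjective_iff.1 this.2⟩
    exact ⟨AffineEquiv.ofBijective hbij, hdet, fun x => rfl⟩
  choose! B hBdet hB using hex
  refine ⟨(fun q => (q.1, B q)) '' T, hT.image _, ?_, fun x => ?_⟩
  · rintro _ ⟨q, hqT, rfl⟩
    refine ⟨(hq q hqT).1, hBdet q hqT, fun x hx => ?_⟩
    change x + ψ x • v = B q x
    rw [hB q hqT, (hq q hqT).2.2 x hx]
  · obtain ⟨q, hqT, hx⟩ := hc x
    exact ⟨_, ⟨q, hqT, rfl⟩, hx⟩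

end Polyhedra

/-! ### Truncated shears as homeomorphisms of the cube. -/

section Shears

variable {n : ℕ}

/-- The affine function `a`, truncated above and below by a tent function supported in the ball of
radius `r` about `p`. -/
noncomputable def truncation (p : Fin n → ℝ) (r : ℝ) (a : (Fin n → ℝ) →ᵃ[ℝ] ℝ) (x : Fin n → ℝ) : ℝ :=
  max (0 - max 0 (r / 2 - ‖x - p‖ / 2)) (0 - max (0 - a x) (0 - max 0 (r / 2 - ‖x - p‖ / 2)))

theorem truncation_of_notMem {p : Fin n → ℝ} {r : ℝ} (a : (Fin n → ℝ) →ᵃ[ℝ] ℝ)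
    {x : Fin n → ℝ} (hx : x ∉ Metric.closedBall p r) : truncation p r a x = 0 := by
  rw [mem_closedBall_iff_norm, not_le] at hx
  have : max 0 (r / 2 - ‖x - p‖ / 2) = 0 := max_eq_left (by linarith)
  rw [truncation, this]
  rcases le_total 0 (a x) with h | h <;> simp [h]

theorem truncation_eq {p : Fin n → ℝ} {r : ℝ} {a : (Fin n → ℝ) →ᵃ[ℝ] ℝ}
    {x : Fin n → ℝ} (hx : |a x| ≤ r / 2 - ‖x - p‖ / 2) : truncation p r a x = a x := by
  have h0 := (abs_nonneg _).trans hx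
  have h1 := abs_le.1 hx
  rw [truncation, max_eq_right h0, max_eq_left (b := 0 - (r / 2 - ‖x - p‖ / 2)) (by linarith),
    max_eq_right (by linarith)]
  ring

/-- The norm on `Fin n → ℝ` is the sup norm, a maximum of the functions `±(x j - p j)`; halving it
keeps the slope along a basis vector within `1 / 2`. -/
theorem isPiecewiseAffine_norm (i : Fin n) (p : Fin n → ℝ) :
    IsPiecewiseAffine (Pi.single i 1) fun x => ‖x - p‖ / 2 := by
  have hne : (Finset.univ : Finset (Fin n)).Nonempty := ⟨i, Finset.mem_univ i⟩
  have : Nonempty (Fin n) := ⟨i⟩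
  let f : Fin n → ((Fin n → ℝ) →ᵃ[ℝ] ℝ) := fun j =>
    (1 / 2 : ℝ) • ((LinearMap.proj j : (Fin n → ℝ) →ₗ[ℝ] ℝ).toAffineMap -
      AffineMap.const ℝ _ (p j))
  have hf : ∀ j x, f j x = (x j - p j) / 2 := fun j x => by simp [f]; ring
  have hslope : ∀ j, |(f j).linear (Pi.single i 1)| ≤ 1 / 2 := by
    intro j
    have : (f j).linear (Pi.single i 1) = 1 / 2 * (Pi.single i 1 : Fin n → ℝ) j := by simp [f]
    rw [this, Pi.single_apply]
    split_ifs <;> norm_num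
  have hpw : ∀ j, IsPiecewiseAffine (Pi.single i 1) ((f j : (Fin n → ℝ) → ℝ) ⊔ fun x => 0 - f j x) :=
    fun j => (isPiecewiseAffine_affineMap _ (hslope j)).sup
      ((isPiecewiseAffine_affineMap _ (hslope j)).const_sub 0)
  have habs : ∀ j x, ((f j : (Fin n → ℝ) → ℝ) ⊔ fun x => 0 - f j x) x = |x j - p j| / 2 := by
    intro j x
    rw [Pi.sup_apply, hf, zero_sub]
    change |(x j - p j) / 2| = _
    rw [abs_div, abs_two]
  have hsup := Finset.sup'_induction (p := IsPiecewiseAffine (Pi.single i 1)) hne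
    (fun j => (f j : (Fin n → ℝ) → ℝ) ⊔ fun x => 0 - f j x) (fun _ h _ h' => h.sup h')
    (fun j _ => hpw j)
  convert! hsup using 1
  ext x
  rw [Finset.sup'_apply]
  apply le_antisymm
  · rw [div_le_iff₀ two_pos, pi_norm_le_iff_of_nonempty]
    intro j
    rw [← div_le_iff₀ two_pos, Pi.sub_apply, Real.norm_eq_abs, ← habs]
    exact Finset.le_sup' (fun j => ((f j : (Fin n → ℝ) → ℝ) ⊔ fun x => 0 - f j x) x)
      (Finset.mem_univ j)
  · refine Finset.sup'_le _ _ fun j _ => ?_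
    rw [habs]
    have := norm_le_pi_norm (x - p) j
    rw [Pi.sub_apply, Real.norm_eq_abs] at this
    linarith

theorem isPiecewiseAffine_truncation (i : Fin n) (p : Fin n → ℝ) (r : ℝ)
    {a : (Fin n → ℝ) →ᵃ[ℝ] ℝ} (ha : |a.linear (Pi.single i 1)| ≤ 1 / 2) :
    IsPiecewiseAffine (Pi.single i 1) (truncation p r a) := by
  have h0 : IsPiecewiseAffine (Pi.single i 1) fun _ : Fin n → ℝ => (0 : ℝ) :=
    isPiecewiseAffine_affineMap (AffineMap.const ℝ _ 0) (by simp)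
  have htent := h0.sup ((isPiecewiseAffine_norm i p).const_sub (r / 2))
  exact (htent.const_sub 0).sup
    (((isPiecewiseAffine_affineMap a ha).const_sub 0).sup (htent.const_sub 0) |>.const_sub 0)

theorem lipschitzWith_truncation (p : Fin n → ℝ) (r : ℝ) {a : (Fin n → ℝ) →ᵃ[ℝ] ℝ}
    (ha : LipschitzWith (1 / 2) a) : LipschitzWith (1 / 2) (truncation p r a) := by
  have hsub : ∀ {f : (Fin n → ℝ) → ℝ} (c : ℝ), LipschitzWith (1 / 2) f →
      LipschitzWith (1 / 2) fun x => c - f x := by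
    intro f c hf
    refine LipschitzWith.of_dist_le_mul fun x y => ?_
    rw [dist_sub_left]
    exact hf.dist_le_mul x y
  have hnorm : LipschitzWith (1 / 2) fun x : Fin n → ℝ => ‖x - p‖ / 2 := by
    refine LipschitzWith.of_dist_le_mul fun x y => ?_
    have := abs_norm_sub_norm_le (x - p) (y - p)
    rw [sub_sub_sub_cancel_right] at this
    rw [Real.dist_eq, ← sub_div, abs_div, abs_two, dist_eq_norm]
    push_cast
    linarith
  have hmax : ∀ {f g : (Fin n → ℝ) → ℝ}, LipschitzWith (1 / 2) f → LipschitzWith (1 / 2) g →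
      LipschitzWith (1 / 2) fun x => max (f x) (g x) := by
    intro f g hf hg
    simpa using hf.max hg
  have htent := hmax ((LipschitzWith.const (0 : ℝ)).weaken zero_le) (hsub (r / 2) hnorm)
  exact hmax (hsub 0 htent) (hsub 0 (hmax (hsub 0 ha) (hsub 0 htent)))

/-- Truncated shears are orientation preserving piecewise linear homeomorphisms of the cube. -/
theorem exists_shear {p : Fin n → ℝ} {r : ℝ} (hpr : Metric.closedBall p r ⊆ Icc 0 1) (i : Fin n)
    {a : (Fin n → ℝ) →ᵃ[ℝ] ℝ} (ha : LipschitzWith (1 / 2) a) :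
    ∃ F : Cube n ≃ₜ Cube n, F.toOpenPartialHomeomorph ∈ orientedPLGroupoid n ∧
      ∀ y : Cube n, (F y : Fin n → ℝ) = (y : Fin n → ℝ) + truncation p r a y • Pi.single i 1 := by
  have : Nonempty (Fin n) := ⟨i⟩
  have hnorm : ‖(Pi.single i 1 : Fin n → ℝ)‖ = 1 := by rw [Pi.norm_single, norm_one]
  have hslope : |a.linear (Pi.single i 1)| ≤ 1 / 2 := by
    have h1 := ha.dist_le_mul (Pi.single i 1) 0
    rw [dist_zero_right, hnorm, Real.dist_eq] at h1
    have h2 : a.linear (Pi.single i 1) = a (Pi.single i 1) - a 0 := by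
      have := a.linearMap_vsub (Pi.single i 1) 0
      simpa using this
    rw [h2]
    simpa using h1
  set S : (Fin n → ℝ) → (Fin n → ℝ) := fun x => x + truncation p r a x • Pi.single i 1 with hS
  -- `S` differs from the identity by a map with Lipschitz constant `1 / 2 < 1`, so it is a
  -- homeomorphism of `ℝⁿ`.
  have happ : ApproximatesLinearOn S
      ((ContinuousLinearEquiv.refl ℝ (Fin n → ℝ) : (Fin n → ℝ) ≃L[ℝ] (Fin n → ℝ)) :
        (Fin n → ℝ) →L[ℝ] (Fin n → ℝ)) univ (1 / 2) := by
    rintro x - y -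
    have h1 := (lipschitzWith_truncation p r ha).dist_le_mul x y
    have h2 : S x - S y - (x - y) =
        (truncation p r a x - truncation p r a y) • (Pi.single i 1 : Fin n → ℝ) := by
      simp only [hS]
      module
    change ‖S x - S y - (x - y)‖ ≤ _
    rw [h2, norm_smul, hnorm, mul_one, ← dist_eq_norm, ← dist_eq_norm]
    exact h1
  have hN : Subsingleton (Fin n → ℝ) ∨ (1 / 2 : NNReal) <
      ‖((ContinuousLinearEquiv.refl ℝ (Fin n → ℝ)).symm :
        (Fin n → ℝ) →L[ℝ] (Fin n → ℝ))‖₊⁻¹ := by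
    right
    have : ‖((ContinuousLinearEquiv.refl ℝ (Fin n → ℝ)).symm :
        (Fin n → ℝ) →L[ℝ] (Fin n → ℝ))‖₊ = 1 := by
      apply NNReal.eq
      exact ContinuousLinearMap.norm_id
    rw [this, inv_one]
    exact NNReal.half_lt_self one_ne_zero
  let F : (Fin n → ℝ) ≃ₜ (Fin n → ℝ) := happ.toHomeomorph S hN
  have hF : ∀ x, F x = S x := fun _ => rfl
  have hFid : ∀ x ∉ Metric.closedBall p r, F x = x := by
    intro x hx
    simp only [hF, hS, truncation_of_notMem a hx, zero_smul, add_zero]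
  -- `F` is injective and fixes everything outside the ball, so it maps the ball, which lies in the
  -- cube, to itself.
  have hpres : ∀ x, x ∈ Icc (0 : Fin n → ℝ) 1 ↔ F x ∈ Icc (0 : Fin n → ℝ) 1 := by
    intro x
    by_cases hx : x ∈ Metric.closedBall p r
    · refine ⟨fun _ => hpr ?_, fun _ => hpr hx⟩
      by_contra h
      have h1 := F.injective (hFid _ h)
      exact h (by rwa [h1])
    · rw [hFid x hx]
  have hPW : IsPiecewiseAffineEquiv F.toEquiv :=
    (isPiecewiseAffine_truncation i p r hslope).shear
  exact ⟨F.subtype hpres,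
    ⟨hPW.isOrientedPLOn (F.subtype hpres).continuous fun _ => rfl,
      hPW.symm.isOrientedPLOn (F.subtype hpres).symm.continuous fun _ => rfl⟩, fun _ => rfl⟩

end Shears

/-! ### Local contractions and pushes, and the conical structure of piecewise linear germs. -/

section CubeMaps

variable {n : ℕ}

/-- The homothety of ratio `1 / 2` about an interior point of the cube, in the coordinates belonging
to `s`, is the germ of a piecewise linear homeomorphism supported near that point. -/
theorem exists_coordinate_contraction (p : Cube n) {r : ℝ} (hr : 0 < r)
    (hpr : Metric.closedBall (p : Fin n → ℝ) r ⊆ Icc 0 1) (s : Finset (Fin n)) :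
    ∃ F : Cube n ≃ₜ Cube n, F.toOpenPartialHomeomorph ∈ orientedPLGroupoid n ∧
      (∀ y : Cube n, (y : Fin n → ℝ) ∉ Metric.closedBall (p : Fin n → ℝ) r → F y = y) ∧
      ∀ᶠ y in 𝓝 p, ∀ j, (F y : Fin n → ℝ) j =
        if j ∈ s then ((y : Fin n → ℝ) j + (p : Fin n → ℝ) j) / 2 else (y : Fin n → ℝ) j := by
  classical
  induction s using Finset.induction_on with
  | empty =>
    refine ⟨Homeomorph.refl _, ?_, fun _ _ => rfl, by simp⟩
    rw [Homeomorph.refl_toOpenPartialHomeomorph]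
    exact (orientedPLGroupoid n).id_mem
  | insert i s his ih =>
    obtain ⟨F, hFG, hFid, hF⟩ := ih
    -- Adding this to the `i`-th coordinate replaces `x i` by the midpoint of `x i` and `p i`;
    -- coordinates are contracted one at a time.
    let a : (Fin n → ℝ) →ᵃ[ℝ] ℝ := (-(1 / 2) : ℝ) •
      ((LinearMap.proj i : (Fin n → ℝ) →ₗ[ℝ] ℝ).toAffineMap -
        AffineMap.const ℝ _ ((p : Fin n → ℝ) i))
    have hax : ∀ x, a x = -(1 / 2) * (x i - (p : Fin n → ℝ) i) := fun x => by simp [a]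
    have ha : LipschitzWith (1 / 2) a := by
      refine LipschitzWith.of_dist_le_mul fun x y => ?_
      have h1 : a x - a y = -(1 / 2) * (x i - y i) := by rw [hax, hax]; ring
      have h2 := dist_le_pi_dist x y i
      rw [Real.dist_eq] at h2
      rw [Real.dist_eq, h1, abs_mul, abs_neg, abs_of_pos (by norm_num : (0 : ℝ) < 1 / 2)]
      push_cast
      linarith
    obtain ⟨S, hSG, hS⟩ := exists_shear hpr i ha
    refine ⟨F.trans S, ?_, fun y hy => ?_, ?_⟩
    · rw [Homeomorph.trans_toOpenPartialHomeomorph]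
      exact (orientedPLGroupoid n).trans hFG hSG
    · rw [Homeomorph.trans_apply, hFid y hy]
      refine Subtype.ext ?_
      rw [hS, truncation_of_notMem a hy, zero_smul, add_zero]
    · have hFp : F p = p := by
        refine Subtype.ext (funext fun j => ?_)
        rw [hF.self_of_nhds j]
        split_ifs
        · ring
        · rfl
      -- Within distance `r / 2` of `p` the tent has height at least `r / 4`, which bounds `|a|`
      -- there, so the truncation has no effect.
      have hnear : ∀ᶠ y in 𝓝 p, F y ∈ Metric.closedBall p (r / 2) := by
        have := F.continuous.tendsto p
        rw [hFp] at this
        exact this (Metric.closedBall_mem_nhds p (half_pos hr))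
      filter_upwards [hF, hnear] with y hy hyn j
      have hn : ‖(F y : Fin n → ℝ) - (p : Fin n → ℝ)‖ ≤ r / 2 := by
        rw [← dist_eq_norm]
        exact hyn
      have hi := norm_le_pi_norm ((F y : Fin n → ℝ) - (p : Fin n → ℝ)) i
      rw [Pi.sub_apply, Real.norm_eq_abs] at hi
      have htr : truncation p r a (F y) = a (F y) := by
        refine truncation_eq ?_
        rw [hax, abs_mul, abs_neg, abs_of_pos (by norm_num : (0 : ℝ) < 1 / 2)]
        linarith
      have hFi := hy i
      rw [if_neg his] at hFi
      rw [Homeomorph.trans_apply, hS, htr, Pi.add_apply, Pi.smul_apply, hax, hFi, hy j]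
      by_cases hj : j = i
      · subst hj
        rw [if_neg his, if_pos (Finset.mem_insert_self _ _), Pi.single_eq_same, smul_eq_mul]
        ring
      · simp [hj]

theorem exists_contraction (p : Cube n) {r : ℝ} (hr : 0 < r)
    (hpr : Metric.closedBall (p : Fin n → ℝ) r ⊆ Icc 0 1) :
    ∃ F : Cube n ≃ₜ Cube n, F.toOpenPartialHomeomorph ∈ orientedPLGroupoid n ∧
      (∀ y : Cube n, (y : Fin n → ℝ) ∉ Metric.closedBall (p : Fin n → ℝ) r → F y = y) ∧
      ∀ᶠ y in 𝓝 p, (F y : Fin n → ℝ) = midpoint ℝ (y : Fin n → ℝ) p := by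
  obtain ⟨F, hFG, hFid, hF⟩ := exists_coordinate_contraction p hr hpr Finset.univ
  refine ⟨F, hFG, hFid, hF.mono fun y hy => funext fun j => ?_⟩
  rw [hy j, if_pos (Finset.mem_univ j), midpoint_eq_smul_add, Pi.smul_apply, Pi.add_apply,
    smul_eq_mul, invOf_eq_inv]
  ring

/-- An interior point of the cube can be pushed slightly in a coordinate direction by a piecewise
linear homeomorphism supported near that point. -/
theorem exists_push (p : Cube n) {r : ℝ} (hpr : Metric.closedBall (p : Fin n → ℝ) r ⊆ Icc 0 1)
    (i : Fin n) {t : ℝ} (ht : t ∈ Ioo 0 (r / 2)) :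
    ∃ F : Cube n ≃ₜ Cube n, F.toOpenPartialHomeomorph ∈ orientedPLGroupoid n ∧
      (∀ y : Cube n, (y : Fin n → ℝ) ∉ Metric.closedBall (p : Fin n → ℝ) r → F y = y) ∧
      (F p : Fin n → ℝ) i = (p : Fin n → ℝ) i + t := by
  have ha : LipschitzWith (1 / 2) (AffineMap.const ℝ (Fin n → ℝ) t) :=
    (LipschitzWith.const t).weaken zero_le
  obtain ⟨S, hSG, hS⟩ := exists_shear hpr i ha
  refine ⟨S, hSG, fun y hy => Subtype.ext ?_, ?_⟩
  · rw [hS, truncation_of_notMem _ hy, zero_smul, add_zero]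
  · rw [hS, truncation_eq]
    · simp
    · simpa [abs_of_pos ht.1] using ht.2.le

theorem exists_closedBall_of_mem_nhds {W : Set (Fin n → ℝ)} (hW : IsOpen W)
    (hWI : W ⊆ Icc 0 1) {y : Cube n} (hy : (y : Fin n → ℝ) ∈ W) {V : Set (Cube n)}
    (hV : V ∈ 𝓝 y) : ∃ r > 0, Metric.closedBall (y : Fin n → ℝ) r ⊆ Icc 0 1 ∧
      ∀ z : Cube n, (z : Fin n → ℝ) ∈ Metric.closedBall (y : Fin n → ℝ) r → z ∈ V := by
  obtain ⟨r₁, h₁, hb₁⟩ := Metric.nhds_basis_closedBall.mem_iff.1 (hW.mem_nhds hy)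
  obtain ⟨r₂, h₂, hb₂⟩ := Metric.nhds_basis_closedBall.mem_iff.1 hV
  exact ⟨min r₁ r₂, lt_min h₁ h₂,
    ((Metric.closedBall_subset_closedBall (min_le_left _ _)).trans hb₁).trans hWI,
    fun z hz => hb₂ (Metric.closedBall_subset_closedBall (min_le_right _ _) hz)⟩

/-- Near a fixed point `q`, a piecewise linear map commutes with the homothety of ratio `1 / 2`
about `q`. -/
theorem IsPLOn.eventually_midpoint {f : Cube n → Cube n} {s : Set (Cube n)} (hf : IsPLOn f s)
    {q : Cube n} (hq : q ∈ s) (hfq : f q = q) :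
    ∀ᶠ y : Cube n in 𝓝 q, ∀ z : Cube n, (z : Fin n → ℝ) = midpoint ℝ (y : Fin n → ℝ) (q : Fin n → ℝ) →
      (f z : Fin n → ℝ) = midpoint ℝ ((f y : Cube n) : Fin n → ℝ) (q : Fin n → ℝ) := by
  obtain ⟨T, hT, hTs, hTn⟩ := hf.exists_simplices q hq
  -- The finitely many simplices missing `q` are closed, so near `q` only those containing `q`
  -- occur. Such a simplex contains the midpoint by convexity.
  have hcl : ∀ᶠ y : Cube n in 𝓝 q, ∀ P ∈ T, (y : Fin n → ℝ) ∈ P → (q : Fin n → ℝ) ∈ P := by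
    refine (Filter.eventually_all_finite hT).2 fun P hP => ?_
    by_cases h : (q : Fin n → ℝ) ∈ P
    · exact Filter.Eventually.of_forall fun _ _ => h
    · have : IsOpen {y : Cube n | (y : Fin n → ℝ) ∉ P} :=
        (hTs P hP).1.isCompact.isClosed.isOpen_compl.preimage continuous_subtype_val
      filter_upwards [this.mem_nhds h] with y hy hyP
      exact absurd hyP hy
  filter_upwards [hTn, hcl] with y ⟨P, hP, hyP⟩ hy z hz
  have hqP := hy P hP hyP
  obtain ⟨A, hA⟩ := (hTs P hP).2.2
  have hzP : (z : Fin n → ℝ) ∈ P := by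
    obtain ⟨σ, -, rfl⟩ := (hTs P hP).1
    rw [hz]
    exact (convex_convexHull ℝ _).midpoint_mem hyP hqP
  rw [hA z hzP, hz, A.map_midpoint, ← hA y hyP, ← hA q hqP, hfq]

end CubeMaps

/-! ### Verification of the abstract criterion on a manifold. -/

section Manifold

variable {n : ℕ} {M : Type*} [TopologicalSpace M] [T2Space M] [ChartedSpace (Cube n) M]

theorem isCompact_preimage_closedBall (p : Fin n → ℝ) (r : ℝ) :
    IsCompact {z : Cube n | (z : Fin n → ℝ) ∈ Metric.closedBall p r} :=
  (Metric.isClosed_closedBall.preimage continuous_subtype_val).isCompact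

/-- Points in the interior of a chart can be moved in uncountably many ways by automorphisms of
small support. -/
theorem exists_uncountable_supportedIn {G : StructureGroupoid (Cube n)}
    (hG : orientedPLGroupoid n ≤ G) [HasGroupoid M G] {e : OpenPartialHomeomorph M (Cube n)}
    (he : e ∈ atlas (Cube n) M) {W : Set (Fin n → ℝ)} (hW : IsOpen W) (hWI : W ⊆ Icc 0 1)
    (i : Fin n) {x : M} (hx : x ∈ e.source) (hxW : (e x : Fin n → ℝ) ∈ W) {N : Set M}
    (hN : N ∈ 𝓝 x) :
    ∃ S : Set (automorphismGroup G M), ¬ S.Countable ∧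
      S ⊆ supportedIn (automorphismGroup G M) N ∧ S.InjOn fun s => s.1 x := by
  have := closedUnderRestriction_of_orientedPLGroupoid_le hG
  have hV : e.symm ⁻¹' N ∩ e.target ∈ 𝓝 (e x) := by
    refine Filter.inter_mem ?_ (e.open_target.mem_nhds (e.map_source hx))
    refine e.symm.continuousAt (e.map_source hx) ?_
    rwa [e.left_inv hx]
  obtain ⟨r, hr, hrI, hrV⟩ := exists_closedBall_of_mem_nhds hW hWI hxW hV
  have hex : ∀ t : Ioo (0 : ℝ) (r / 2), ∃ g ∈ supportedIn (automorphismGroup G M) N,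
      (e (g.1 x) : Fin n → ℝ) i = (e x : Fin n → ℝ) i + t := by
    intro t
    obtain ⟨F, hFG, hFid, hFt⟩ := exists_push (e x) hrI i t.2
    have hK : {z : Cube n | (z : Fin n → ℝ) ∈ Metric.closedBall (e x : Fin n → ℝ) r} ⊆ e.target :=
      fun z hz => (hrV z hz).2
    refine ⟨⟨_, extendById_mem_automorphismGroup G he (isCompact_preimage_closedBall _ _) hK hFid
      (StructureGroupoid.le_iff.1 hG _ hFG)⟩, ?_, ?_⟩
    · intro y hy
      refine extendByIdFun_of_notMem_image hFid ?_
      rintro ⟨z, hz, rfl⟩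
      exact hy (hrV z hz).1
    · change (e (extendByIdFun e F x) : Fin n → ℝ) i = _
      rw [extendByIdFun_of_mem _ hx, e.right_inv (mapsTo_target hK hFid (e.map_source hx)), hFt]
  choose φ hφN hφ using hex
  have hinj : ∀ t t', (φ t).1 x = (φ t').1 x → t = t' := by
    intro t t' htt
    have h1 := hφ t
    rw [htt, hφ t'] at h1
    exact Subtype.ext (add_left_cancel h1).symm
  refine ⟨range φ, fun hc => ?_, ?_, ?_⟩
  · have h1 : Countable (Ioo (0 : ℝ) (r / 2)) := by
      have := hc.to_subtype
      have h2 : Function.Injective (rangeFactorization φ) := fun t t' h =>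
        hinj t t' (congrArg (fun g : automorphismGroup G M => g.1 x) (congrArg Subtype.val h))
      exact h2.countable
    -- The pushes are indexed injectively by an interval of positive length, which has the
    -- cardinality of the continuum.
    have h2 := Cardinal.le_aleph0_iff_set_countable.2 (countable_coe_iff.1 h1)
    rw [Cardinal.mk_Ioo_real (half_pos hr)] at h2
    exact h2.not_gt Cardinal.aleph0_lt_continuum
  · rintro _ ⟨t, rfl⟩
    exact hφN t
  · rintro _ ⟨t, rfl⟩ _ ⟨t', rfl⟩ h
    rw [hinj t t' h]

/-- The automorphism group of a structure between oriented piecewise linear and piecewise linear on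
a nonempty manifold of positive dimension admits no Polish group topology. -/
theorem not_admitsPolishGroupTopology_automorphismGroup [Nonempty M] (hn : 1 ≤ n)
    {G : StructureGroupoid (Cube n)} (hG : orientedPLGroupoid n ≤ G) (hG' : G ≤ plGroupoid n)
    [HasGroupoid M G] : ¬ AdmitsPolishGroupTopology (automorphismGroup G M) := by
  have := closedUnderRestriction_of_orientedPLGroupoid_le hG
  let i : Fin n := ⟨0, hn⟩
  obtain ⟨x₀⟩ := ‹Nonempty M›
  set e := chartAt (Cube n) x₀
  have he : e ∈ atlas (Cube n) M := chart_mem_atlas _ x₀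
  -- The base point is moved to an interior point of the cube, so that small balls of `ℝⁿ` around it
  -- lie in the chart and boundary points of `M` play no role.
  obtain ⟨W, hW, ⟨w, hw⟩, hWe⟩ :=
    exists_isOpen_subset_cube e.open_target ⟨e x₀, mem_chart_target _ x₀⟩
  have hWI : W ⊆ Icc 0 1 := by
    intro z hz
    obtain ⟨y, -, rfl⟩ := hWe hz
    exact y.2
  obtain ⟨q, hq, rfl⟩ := hWe hw
  have hp : e.symm q ∈ e.source := e.map_target hq
  have hep : e (e.symm q) = q := e.right_inv hq
  have hsymm : Filter.Tendsto e.symm (𝓝 q) (𝓝 (e.symm q)) := e.symm.continuousAt hq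
  have hchart : Filter.Tendsto e (𝓝 (e.symm q)) (𝓝 q) := by
    have := e.continuousAt hp
    rwa [ContinuousAt, hep] at this
  have hcg : (𝓝 (e.symm q)).IsCountablyGenerated := by
    rw [← e.symm.map_nhds_eq hq]
    infer_instance
  obtain ⟨r, hr, hrI, hrV⟩ := exists_closedBall_of_mem_nhds hW hWI hw (e.open_target.mem_nhds hq)
  obtain ⟨F, hFG, hFid, hF⟩ := exists_contraction q hr hrI
  have hK : {z : Cube n | (z : Fin n → ℝ) ∈ Metric.closedBall (q : Fin n → ℝ) r} ⊆ e.target :=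
    fun z hz => hrV z hz
  let h : automorphismGroup G M := ⟨_, extendById_mem_automorphismGroup G he
    (isCompact_preimage_closedBall _ _) hK hFid (StructureGroupoid.le_iff.1 hG _ hFG)⟩
  have hx : ∀ x ∈ e.source, h.1 x = e.symm (F (e x)) := fun x hx => extendByIdFun_of_mem F hx
  have hFq : F q = q := Subtype.ext (by rw [hF.self_of_nhds, midpoint_self])
  have hhp : h.1 (e.symm q) = e.symm q := by rw [hx _ hp, hep, hFq]
  have hcoord : Continuous fun z : Cube n => (z : Fin n → ℝ) i :=
    (continuous_apply i).comp continuous_subtype_val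
  have hclosure : ∀ {u : Set ℝ}, (∀ ρ > 0, ∃ t, |t| ≤ ρ ∧ (q : Fin n → ℝ) i + t ∈ u) →
      e.symm q ∈ closure (e.source ∩ e ⁻¹' {z : Cube n | (z : Fin n → ℝ) i ∈ u}) := by
    intro u hu
    refine mem_closure_iff_nhds.2 fun N hN => ?_
    obtain ⟨ρ, hρ, hρI, hρV⟩ := exists_closedBall_of_mem_nhds hW hWI hw
      (Filter.inter_mem (hsymm hN) (e.open_target.mem_nhds hq))
    obtain ⟨t, ht, htu⟩ := hu ρ hρ
    have hmem : (q : Fin n → ℝ) + Pi.single i t ∈ Metric.closedBall (q : Fin n → ℝ) ρ := by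
      rw [mem_closedBall_iff_norm, add_sub_cancel_left, Pi.norm_single]
      exact ht
    obtain ⟨h1, h2⟩ := hρV ⟨_, hρI hmem⟩ hmem
    refine ⟨_, h1, e.map_target h2, ?_⟩
    rw [mem_preimage, e.right_inv h2]
    simpa using htu
  -- `L` and `R` are the two open sides, inside the chart, of the hyperplane through `q` orthogonal
  -- to the `i`-th axis.
  refine not_admitsPolishGroupTopology_of_conical _ (e.symm q) h ?_
    (O := e.source ∩ e ⁻¹' {z : Cube n | (z : Fin n → ℝ) ∈ W})
    (L := e.source ∩ e ⁻¹' {z : Cube n | (z : Fin n → ℝ) i ∈ Iio ((q : Fin n → ℝ) i)})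
    (R := e.source ∩ e ⁻¹' {z : Cube n | (z : Fin n → ℝ) i ∈ Ioi ((q : Fin n → ℝ) i)})
    (e.isOpen_inter_preimage (hW.preimage continuous_subtype_val)) ⟨hp, by simpa [hep] using hw⟩
    (e.isOpen_inter_preimage (isOpen_Iio.preimage hcoord))
    (e.isOpen_inter_preimage (isOpen_Ioi.preimage hcoord))
    ?_ (hclosure fun ρ hρ => ⟨-ρ, by simp [abs_of_pos hρ], by simpa using hρ⟩)
    (hclosure fun ρ hρ => ⟨ρ, by simp [abs_of_pos hρ], by simpa using hρ⟩) ?_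
    fun x hx N hN => exists_uncountable_supportedIn hG he hW hWI i hx.1 hx.2 hN
  · intro g hg
    have hpl : IsPLOn (fun y => e (g.1 (e.symm y)))
        (e.symm ≫ₕ g.1.toOpenPartialHomeomorph ≫ₕ e).source := (StructureGroupoid.le_iff.1 hG' _ (g.2 e he e he)).1
    have hqs : q ∈ (e.symm ≫ₕ g.1.toOpenPartialHomeomorph ≫ₕ e).source := by
      simp only [mfld_simps, mem_preimage,
        Homeomorph.toOpenPartialHomeomorph_apply, hg]
      exact ⟨hq, hp⟩
    have hmid := hpl.eventually_midpoint hqs (by rw [hg, hep])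
    have hgt : Filter.Tendsto g.1 (𝓝 (e.symm q)) (𝓝 (e.symm q)) := by
      have := g.1.continuous.tendsto (e.symm q)
      rwa [hg] at this
    have hht : Filter.Tendsto h.1 (𝓝 (e.symm q)) (𝓝 (e.symm q)) := by
      have := h.1.continuous.tendsto (e.symm q)
      rwa [hhp] at this
    have hsrc := e.open_source.mem_nhds hp
    filter_upwards [hsrc, hgt hsrc, (hgt.comp hht) hsrc, hchart.eventually hmid,
      hchart.eventually hF, (hchart.comp hgt).eventually hF] with x h1 h2 h3 h4 h5 h6
    have h7 := h4 (F (e x)) h5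
    rw [e.left_inv h1, ← hx x h1] at h7
    have h8 : e (g.1 (h.1 x)) = F (e (g.1 x)) := Subtype.ext (h7.trans h6.symm)
    rw [hx _ h2, ← h8]
    exact (e.left_inv h3).symm
  · refine Set.disjoint_left.2 fun x hxL hxR => ?_
    exact lt_asymm (show (e x : Fin n → ℝ) i < (q : Fin n → ℝ) i from hxL.2) hxR.2
  -- A point fixed by `h` near `p` equals its own midpoint with `q` in the chart, so its `i`-th
  -- coordinate is that of `q`, which is excluded on `R`.
  · filter_upwards [hchart.eventually hF] with x hxF hxR hfix
    rw [hx x hxR.1] at hfix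
    have h1 := e.right_inv (mapsTo_target hK hFid (e.map_source hxR.1))
    rw [hfix] at h1
    rw [← h1] at hxF
    have h2 := congrFun hxF i
    rw [midpoint_eq_smul_add, Pi.smul_apply, Pi.add_apply, smul_eq_mul, invOf_eq_inv] at h2
    have h3 : (q : Fin n → ℝ) i < (e x : Fin n → ℝ) i := hxR.2
    linarith

end Manifold

end PLGroup

theorem theorem1p1 (n : ℕ) (hn : 1 ≤ n) (M : Type*) [TopologicalSpace M] [T2Space M] [Nonempty M]
    [ChartedSpace (PLGroup.Cube n) M] :
    (∀ [HasGroupoid M (PLGroup.plGroupoid n)],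
      ¬ PLGroup.AdmitsPolishGroupTopology (PLGroup.PL n M)) ∧
    (∀ [HasGroupoid M (PLGroup.orientedPLGroupoid n)],
      ¬ PLGroup.AdmitsPolishGroupTopology (PLGroup.OrientedPL n M)) := by
  constructor
  · intro _
    exact PLGroup.not_admitsPolishGroupTopology_automorphismGroup hn
      PLGroup.orientedPLGroupoid_le_plGroupoid le_rfl
  · intro _
    exact PLGroup.not_admitsPolishGroupTopology_automorphismGroup hn le_rfl
      PLGroup.orientedPLGroupoid_le_plGroupoid
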